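/- Links in $S^3$ and ball tangles (proper $1$-submanifolds $T$ of a $3$-ball with four fixed boundary points NW, NE, SW, SE, that is, two arcs and finitely many circles) are given by their diagrams, considered up to planar isotopy and Reidemeister moves (for ball tangles, with fixed endpoints). For a link diagram $D$ let $$\langle D\rangle=\sum_{\sigma}A^{\alpha(\sigma)}(A^{-1})^{\beta(\sigma)}(-A^2-A^{-2})^{d(\sigma)-1}$$ be its Kauffman bracket at $A=e^{i\pi/4}$. Here $\sigma$ runs over all states of $D$ (choices of an $A$-type or a $B$-type splitting at each crossing), $\alpha(\sigma)$ and $\beta(\sigma)$ are the numbers of $A$-type and $B$-type splittings in $\sigma$, and $d(\sigma)$ is the number of circles after the splittings. For a ball tangle $B$ with diagram $D$ let $D_1$ be the numerator closure (NW joined to NE, SW to SE) and $D_2$ the denominator closure (NW joined to SW, NE to SE). The (Krebes) invariant of $B$ is $\begin{bmatrix}p\\q\end{bmatrix}=\{(p,q),(-p,-q)\}$ if $$\{(z\langle D_1\rangle,\ i z\langle D_2\rangle)\mid z\in\mathbb C,\ z^8=1\}\cap\mathbb Z^2=\{(p,q),(-p,-q)\}.$$ Ball tangles $B^{(1)},\dots,B^{(n)}$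 are embedded disjointly in a link $L$ if $L$ has a diagram that meets $n$ disjoint disks in diagrams of $B^{(1)},\dots,B^{(n)}$, respectively, where $B^{(i)}$ may be replaced by its mirror image (the embedding of a ball may reverse the orientation). **Theorem 3.7.** Let $L$ be a link and let $B^{(1)},\dots,B^{(n)}$ be ball tangles with the invariants $\begin{bmatrix}p_1\\q_1\end{bmatrix},\dots,\begin{bmatrix}p_n\\q_n\end{bmatrix}$. If $B^{(1)},\dots,B^{(n)}$ are embedded disjointly in $L$, then for every diagram $D$ of $L$ the number $|\langle L\rangle|=|\langle D\rangle|$ is an integer, and $$\prod_{i=1}^{n}\gcd(p_i,q_i)\quad\text{divides}\quad|\langle L\rangle|.$$ -/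

import Mathlib

/-!
Link and tangle diagrams, the Kauffman bracket, and the ball tangle invariant.

Diagrams are plane diagrams in Morse position, cut by horizontal lines into elementary
slices and read from bottom to top. Each slice contains one local minimum (`cup`), one local
maximum (`cap`), one crossing, or one round hole meeting the diagram in four points, and
vertical strands to the left and to the right of it. Every plane diagram is planar isotopic to
one of this form. Links and tangles are diagrams up to planar isotopy and Reidemeister moves.
-/

namespace TangleDiagrams

/-- The nontrivial part of a slice. In `crossing true` the over-strand runs from bottom left to
top right, in `crossing false` it runs from bottom right to top left. The holes are labelled
by `ι`; diagrams of links and of ball tangles have no holes, `ι = Empty`. -/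
inductive Kind (ι : Type) : Type
  | cup : Kind ι
  | cap : Kind ι
  | crossing (slash : Bool) : Kind ι
  | hole (i : ι) : Kind ι

/-- The number of strands that enter from below. -/
def Kind.ins {ι : Type} : Kind ι → ℕ
  | .cup => 0
  | .cap => 2
  | .crossing _ => 2
  | .hole _ => 2

/-- The number of strands that leave at the top. -/
def Kind.outs {ι : Type} : Kind ι → ℕ
  | .cup => 2
  | .cap => 0
  | .crossing _ => 2
  | .hole _ => 2

/-- A slice: its nontrivial part, with `pos` vertical strands to the left of it. -/
structure Slice (ι : Type) : Type where
  kind : Kind ι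
  pos : ℕ

/-- `Fits a w b`: the stack of slices `w`, read from bottom to top, is a diagram with `a`
endpoints at the bottom and `b` endpoints at the top. -/
def Fits {ι : Type} : ℕ → List (Slice ι) → ℕ → Prop
  | a, [], b => a = b
  | a, s :: w, b => s.pos + s.kind.ins ≤ a ∧ Fits (a - s.kind.ins + s.kind.outs) w b

/-- Diagrams with `a` bottom endpoints, `b` top endpoints and holes labelled by `ι`. -/
structure Diagram (ι : Type) (a b : ℕ) : Type where
  word : List (Slice ι)
  fits : Fits a word b

/-- Link diagrams. -/
abbrev LinkDiagram : Type := Diagram Empty 0 0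

/-- Ball tangle diagrams: the four endpoints are two at the bottom (SW, SE) and two at the
top (NW, NE). -/
abbrev BallTangleDiagram : Type := Diagram Empty 2 2

/-! ### Isotopy -/

/-- The local moves. -/
inductive LocalMove {ι : Type} : List (Slice ι) → List (Slice ι) → Prop
  /-- Planar isotopy: two parts that lie side by side change their heights. -/
  | interchange (s t : Kind ι) (k m : ℕ) :
      LocalMove [⟨s, k⟩, ⟨t, k + s.outs + m⟩] [⟨t, k + s.ins + m⟩, ⟨s, k⟩]
  /-- Planar isotopy: a local minimum and a local maximum cancel. -/
  | zigzagLeft (k : ℕ) : LocalMove [⟨.cup, k + 1⟩, ⟨.cap, k⟩] []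
  | zigzagRight (k : ℕ) : LocalMove [⟨.cup, k⟩, ⟨.cap, k + 1⟩] []
  /-- Planar isotopy: a crossing slides through a local minimum or a local maximum. -/
  | slideCup (o : Bool) (k : ℕ) :
      LocalMove [⟨.cup, k⟩, ⟨.crossing o, k + 1⟩] [⟨.cup, k + 1⟩, ⟨.crossing (!o), k⟩]
  | slideCap (o : Bool) (k : ℕ) :
      LocalMove [⟨.crossing o, k + 1⟩, ⟨.cap, k⟩] [⟨.crossing (!o), k⟩, ⟨.cap, k + 1⟩]
  /-- Reidemeister move of type I. -/
  | reidemeisterOneCup (o : Bool) (k : ℕ) :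
      LocalMove [⟨.cup, k⟩, ⟨.crossing o, k⟩] [⟨.cup, k⟩]
  | reidemeisterOneCap (o : Bool) (k : ℕ) :
      LocalMove [⟨.crossing o, k⟩, ⟨.cap, k⟩] [⟨.cap, k⟩]
  /-- Reidemeister move of type II. -/
  | reidemeisterTwo (o : Bool) (k : ℕ) :
      LocalMove [⟨.crossing o, k⟩, ⟨.crossing (!o), k⟩] []
  /-- Reidemeister move of type III. The hypothesis says that of the three strands one runs
  above the two others and one runs below the two others. -/
  | reidemeisterThree (o₁₂ o₁₃ o₂₃ : Bool) (h : o₁₂ = o₁₃ ∨ o₁₃ = o₂₃) (k : ℕ) :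
      LocalMove [⟨.crossing o₁₂, k⟩, ⟨.crossing o₁₃, k + 1⟩, ⟨.crossing o₂₃, k⟩]
        [⟨.crossing o₂₃, k + 1⟩, ⟨.crossing o₁₃, k⟩, ⟨.crossing o₁₂, k + 1⟩]

/-- Two diagrams differ by one local move. -/
def Step {ι : Type} {a b : ℕ} (D D' : Diagram ι a b) : Prop :=
  ∃ u x y v : List (Slice ι),
    LocalMove x y ∧ D.word = u ++ x ++ v ∧ D'.word = u ++ y ++ v

/-- Isotopy of diagrams: a finite sequence of moves and inverse moves. The endpoints are fixed. -/
def isotopy (ι : Type) (a b : ℕ) : Setoid (Diagram ι a b) :=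
  Relation.EqvGen.setoid Step

/-- Isotopy classes of links. -/
def Link : Type := Quotient (isotopy Empty 0 0)

/-- Isotopy classes of ball tangles, relative to the boundary of the ball. -/
def BallTangle : Type := Quotient (isotopy Empty 2 2)

/-- `D` is a diagram of the link `L`. -/
def LinkDiagram.Represents (D : LinkDiagram) (L : Link) : Prop :=
  Quotient.mk (isotopy Empty 0 0) D = L

/-- `D` is a diagram of the ball tangle `B`. -/
def BallTangleDiagram.Represents (D : BallTangleDiagram) (B : BallTangle) : Prop :=
  Quotient.mk (isotopy Empty 2 2) D = B

/-! ### Operations on diagrams -/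

/-- Put `k` vertical strands to the left. -/
def shift {ι : Type} (k : ℕ) (w : List (Slice ι)) : List (Slice ι) :=
  w.map fun s => ⟨s.kind, k + s.pos⟩

theorem Fits.append {ι : Type} {u v : List (Slice ι)} {a b c : ℕ}
    (hu : Fits a u b) (hv : Fits b v c) : Fits a (u ++ v) c := by
  induction u generalizing a with
  | nil => simp only [Fits] at hu; subst hu; simpa using hv
  | cons s u ih => exact ⟨hu.1, ih hu.2⟩

theorem Fits.shift {ι : Type} {w : List (Slice ι)} {a b : ℕ} (h : Fits a w b) (k r : ℕ) :
    Fits (k + a + r) (shift k w) (k + b + r) := by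
  induction w generalizing a with
  | nil => simp only [Fits] at h; subst h; simp [TangleDiagrams.shift, Fits]
  | cons s w ih =>
    obtain ⟨h1, h2⟩ := h
    refine ⟨show k + s.pos + s.kind.ins ≤ k + a + r by omega, ?_⟩
    have := ih h2
    have e : k + (a - s.kind.ins + s.kind.outs) + r =
        k + a + r - s.kind.ins + s.kind.outs := by omega
    rwa [e] at this

/-- Replace every hole by the diagram assigned to its label. -/
def fillWord {ι κ : Type} (E : ι → Diagram κ 2 2) : List (Slice ι) → List (Slice κ)
  | [] => []
  | ⟨.cup, k⟩ :: w => ⟨.cup, k⟩ :: fillWord E w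
  | ⟨.cap, k⟩ :: w => ⟨.cap, k⟩ :: fillWord E w
  | ⟨.crossing o, k⟩ :: w => ⟨.crossing o, k⟩ :: fillWord E w
  | ⟨.hole i, k⟩ :: w => shift k (E i).word ++ fillWord E w

theorem Fits.fillWord {ι κ : Type} (E : ι → Diagram κ 2 2) {w : List (Slice ι)} {a b : ℕ}
    (h : Fits a w b) : Fits a (fillWord E w) b := by
  induction w generalizing a with
  | nil => exact h
  | cons s w ih =>
    obtain ⟨h1, h2⟩ := h
    obtain ⟨s, k⟩ := s
    cases s with
    | cup => exact ⟨h1, ih h2⟩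
    | cap => exact ⟨h1, ih h2⟩
    | crossing o => exact ⟨h1, ih h2⟩
    | hole i =>
      simp only [Kind.ins, Kind.outs] at h1 h2
      have h3 := (E i).fits.shift k (a - (k + 2))
      have h4 : k + 2 + (a - (k + 2)) = a := by omega
      have h5 : a - 2 + 2 = a := by omega
      rw [h4] at h3
      rw [h5] at h2
      exact h3.append (ih h2)

/-- Fill the hole with label `i` by the tangle diagram `E i`, for every `i`. -/
def Diagram.fill {ι κ : Type} {a b : ℕ} (T : Diagram ι a b) (E : ι → Diagram κ 2 2) :
    Diagram κ a b :=
  ⟨fillWord E T.word, T.fits.fillWord E⟩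

/-- The labels of the holes, from bottom to top. -/
def holes {ι : Type} : List (Slice ι) → List ι
  | [] => []
  | ⟨.cup, _⟩ :: w => holes w
  | ⟨.cap, _⟩ :: w => holes w
  | ⟨.crossing _, _⟩ :: w => holes w
  | ⟨.hole i, _⟩ :: w => i :: holes w

/-- Interchange over-strands and under-strands. -/
def Kind.mirror {ι : Type} : Kind ι → Kind ι
  | .cup => .cup
  | .cap => .cap
  | .crossing o => .crossing (!o)
  | .hole i => .hole i

theorem Fits.mirror {ι : Type} {w : List (Slice ι)} {a b : ℕ} (h : Fits a w b) :
    Fits a (w.map fun s => ⟨s.kind.mirror, s.pos⟩) b := by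
  induction w generalizing a with
  | nil => exact h
  | cons s w ih =>
    obtain ⟨h1, h2⟩ := h
    obtain ⟨s, k⟩ := s
    cases s <;> exact ⟨h1, ih h2⟩

/-- The mirror image of a diagram, that is, the diagram of the image under the reflection in
the projection plane. -/
def Diagram.mirror {ι : Type} {a b : ℕ} (D : Diagram ι a b) : Diagram ι a b :=
  ⟨D.word.map fun s => ⟨s.kind.mirror, s.pos⟩, D.fits.mirror⟩

/-- The ball tangles `B i` are embedded disjointly in the link `L`: some diagram of `L` is
obtained from a diagram with exactly one hole for each `i` by filling each hole `i` with a diagram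
of `B i` or, if the embedding of that ball reverses the orientation, of its mirror image. -/
def DisjointlyEmbedded {n : ℕ} (B : Fin n → BallTangle) (L : Link) : Prop :=
  ∃ (T : Diagram (Fin n) 0 0) (E : Fin n → BallTangleDiagram),
    (∀ i, (holes T.word).count i = 1) ∧
    (∀ i, BallTangleDiagram.Represents (E i) (B i) ∨
      BallTangleDiagram.Represents (E i).mirror (B i)) ∧
    LinkDiagram.Represents (T.fill E) L

/-- The numerator closure: NW is joined to NE and SW to SE. -/
def BallTangleDiagram.numerator (D : BallTangleDiagram) : LinkDiagram :=
  ⟨[⟨.cup, 0⟩] ++ D.word ++ [⟨.cap, 0⟩],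
    Fits.append (b := 2) (Fits.append (b := 2) (by simp [Fits, Kind.ins, Kind.outs]) D.fits)
      (by simp [Fits, Kind.ins, Kind.outs])⟩

/-- The denominator closure: NW is joined to SW and NE to SE. -/
def BallTangleDiagram.denominator (D : BallTangleDiagram) : LinkDiagram :=
  ⟨[⟨.cup, 0⟩, ⟨.cup, 2⟩] ++ shift 1 D.word ++ [⟨.cap, 2⟩, ⟨.cap, 0⟩],
    Fits.append (b := 4) (Fits.append (b := 4) (by simp [Fits, Kind.ins, Kind.outs])
      (D.fits.shift 1 1)) (by simp [Fits, Kind.ins, Kind.outs])⟩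

/-! ### The Kauffman bracket -/

/-- The number of crossings. -/
def numCrossings {ι : Type} : List (Slice ι) → ℕ
  | [] => 0
  | ⟨.cup, _⟩ :: w => numCrossings w
  | ⟨.cap, _⟩ :: w => numCrossings w
  | ⟨.crossing _, _⟩ :: w => numCrossings w + 1
  | ⟨.hole _, _⟩ :: w => numCrossings w

/-- A state chooses a splitting for each crossing (numbered from bottom to top): `true` is the
`A`-type splitting and `false` is the `B`-type splitting. -/
abbrev State {ι : Type} (w : List (Slice ι)) : Type := Fin (numCrossings w) → Bool

/-- The result of splitting the crossing `⟨.crossing o, k⟩` by type `t`. If the over-strand runs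
from bottom left to top right (`o = true`), then turning it counterclockwise it passes over the
upper and the lower region. These are the `A`-regions, so the `A`-type splitting gives two
vertical strands and the `B`-type splitting gives a maximum below a minimum.
If `o = false`, the two are exchanged. -/
def split {ι : Type} (o t : Bool) (k : ℕ) : List (Slice ι) :=
  if o = t then [] else [⟨.cap, k⟩, ⟨.cup, k⟩]

/-- The diagram without crossings that a state produces. -/
def smooth {ι : Type} : (w : List (Slice ι)) → State w → List (Slice ι)
  | [], _ => []
  | ⟨.cup, k⟩ :: w, σ => ⟨.cup, k⟩ :: smooth w σ
  | ⟨.cap, k⟩ :: w, σ => ⟨.cap, k⟩ :: smooth w σ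
  | ⟨.crossing o, k⟩ :: w, (σ : Fin (numCrossings w + 1) → Bool) =>
    split o (σ 0) k ++ smooth w (fun i => σ i.succ)
  | ⟨.hole i, k⟩ :: w, σ => ⟨.hole i, k⟩ :: smooth w σ

/-- The number of strands at level `j`, that is, above the first `j` slices, if there are none
at level `0`. -/
def width {ι : Type} (w : List (Slice ι)) (j : ℕ) : ℕ :=
  (w.take j).foldl (fun a s => a - s.kind.ins + s.kind.outs) 0

/-- The points `(j, x)` in which the diagram meets the horizontal lines between the slices: the
point number `x` (from the left) at level `j`. -/
def Points {ι : Type} (w : List (Slice ι)) : Type :=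
  {p : ℕ × ℕ // p.1 ≤ w.length ∧ p.2 < width w p.1}

/-- The arcs in the slice between the levels `j` and `j + 1`, as pairs of endpoints. -/
inductive Slice.Arc {ι : Type} (j : ℕ) : Slice ι → ℕ × ℕ → ℕ × ℕ → Prop
  | left (s : Slice ι) (x : ℕ) (h : x < s.pos) : Slice.Arc j s (j, x) (j + 1, x)
  | right (s : Slice ι) (x : ℕ) :
      Slice.Arc j s (j, s.pos + s.kind.ins + x) (j + 1, s.pos + s.kind.outs + x)
  | cup (k : ℕ) : Slice.Arc j ⟨.cup, k⟩ (j + 1, k) (j + 1, k + 1)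
  | cap (k : ℕ) : Slice.Arc j ⟨.cap, k⟩ (j, k) (j, k + 1)
  | slash (o : Bool) (k : ℕ) : Slice.Arc j ⟨.crossing o, k⟩ (j, k) (j + 1, k + 1)
  | backslash (o : Bool) (k : ℕ) : Slice.Arc j ⟨.crossing o, k⟩ (j, k + 1) (j + 1, k)

/-- Two points are the endpoints of an arc of the diagram in one slice. -/
def Joined {ι : Type} (w : List (Slice ι)) (p q : Points w) : Prop :=
  ∃ (j : ℕ) (hj : j < w.length), Slice.Arc j w[j] p.1 q.1

/-- The number of closed curves of a diagram without endpoints. -/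
noncomputable def numCircles {ι : Type} (w : List (Slice ι)) : ℕ :=
  Nat.card (Quot (Joined w))

/-- The Kauffman bracket, as the sum over all states `σ` of
`A ^ α(σ) * A⁻¹ ^ β(σ) * (-A² - A⁻²) ^ (d(σ) - 1)`, where `α(σ)` and `β(σ)` are the numbers of
`A`-type and `B`-type splittings in `σ` and `d(σ)` is the number of circles it produces. -/
noncomputable def kauffmanBracket (A : ℂ) (D : LinkDiagram) : ℂ :=
  ∑ σ : State D.word,
    A ^ (Finset.univ.filter fun c => σ c = true).card *
      A⁻¹ ^ (Finset.univ.filter fun c => σ c = false).card *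
      (-A ^ 2 - A⁻¹ ^ 2) ^ ((numCircles (smooth D.word σ) : ℤ) - 1)

/-- The Kauffman bracket at `A = exp(iπ/4)`. -/
noncomputable def bracket (D : LinkDiagram) : ℂ :=
  kauffmanBracket (Complex.exp (Complex.I * Real.pi / 4)) D

/-! ### The ball tangle invariant -/

/-- The set of all integral vectors among the `(z * ⟨D₁⟩, i * z * ⟨D₂⟩)`, where `z ^ 8 = 1` and
`D₁`, `D₂` are the numerator closure and the denominator closure of `D`. -/
def invariant (D : BallTangleDiagram) : Set (ℤ × ℤ) :=
  {v | ∃ z : ℂ, z ^ 8 = 1 ∧ z * bracket D.numerator = v.1 ∧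
    Complex.I * z * bracket D.denominator = v.2}

/-- The ball tangle `B` has the invariant `[p; q]`, the class of `(p, q)` modulo sign. -/
def BallTangle.HasInvariant (B : BallTangle) (p q : ℤ) : Prop :=
  ∃ D : BallTangleDiagram, D.Represents B ∧ invariant D = {(p, q), (-p, -q)}

end TangleDiagrams

/-! At `A = exp(iπ/4)` a circle has the value `-A² - A⁻² = 0`, so only states with exactly one
circle contribute to the bracket. Modulo the Kauffman relation a tangle is `a • 1 + b • U`, with `1`
two vertical strands and `U` a maximum below a minimum. In each closure one of the two trivial
tangles makes an extra circle, so `⟨D₁⟩ = a` and `⟨D₂⟩ = b`. A tangle with the invariant `[p; q]` is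
therefore, up to a complex unit, `p • 1 - i q • U` (`tangleOp`), which is `gcd(p, q)` times a tangle
operator with integral coefficients. The bracket of a filled diagram is multilinear in its holes, so
the product of the gcds comes out, and it remains to show that the other factor is a unit times an
integer.

For this, diagrams act as operators on functions of colourings of strands by `Bool` (`Pairing.eval`,
`spinPairing`). There are infinitely many strands, so diagrams of all widths act on one space. A
closed diagram would give 0; opening its lowest minimum lowers the exponent `d` to `d - 1` and makes
the bracket a matrix coefficient (`bracket_cup_cons`). After rescaling colourings by powers of `i`,
the integral tangle operators, the crossings among them, preserve integral functions up to units
(`exists_mapsLattice_eval`).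

Two further points are needed. The circle counts in the bracket are obtained from the same formalism
with circle value 2, which counts 2-colourings of the circles (`two_pow_numCircles`). The absolute
value of the bracket is an isotopy invariant (`norm_bracket_eq_of_isotopic`), so any diagram of the
link may be used. Mirror images conjugate `a` and `b` and so only change the sign of `q`
(`exists_spinEval_of_hasInvariant`). -/

namespace TangleDiagrams

/-! ### Operators on functions of colourings of infinitely many strands -/

/-- Put one term in front of a sequence. -/
def seqCons {α : Type} (a : α) (s : ℕ → α) : ℕ → α
  | 0 => a
  | n + 1 => s n

/-- Remove the first term of a sequence. -/
def seqTail {α : Type} (s : ℕ → α) : ℕ → α := fun n => s (n + 1)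

@[simp] theorem seqCons_zero {α : Type} (a : α) (s : ℕ → α) : seqCons a s 0 = a := rfl

@[simp] theorem seqCons_succ {α : Type} (a : α) (s : ℕ → α) (n : ℕ) :
    seqCons a s (n + 1) = s n := rfl

@[simp] theorem seqCons_one {α : Type} (a : α) (s : ℕ → α) : seqCons a s 1 = s 0 := rfl

@[simp] theorem seqTail_seqCons {α : Type} (a : α) (s : ℕ → α) : seqTail (seqCons a s) = s := rfl

@[simp] theorem seqTail_apply {α : Type} (s : ℕ → α) (n : ℕ) : seqTail s n = s (n + 1) := rfl

@[simp] theorem seqCons_seqTail {α : Type} (s : ℕ → α) : seqCons (s 0) (seqTail s) = s := by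
  funext n; cases n <;> rfl

/-- Functions of the colourings of infinitely many strands by two colours. -/
abbrev StateSpace : Type := (ℕ → Bool) → ℂ

/-- The operators on the state space. -/
abbrev Op : Type := Module.End ℂ StateSpace

/-- Fix the colour of the first strand. -/
def fixFirst (a : Bool) : StateSpace →ₗ[ℂ] StateSpace where
  toFun y := fun s => y (seqCons a s)
  map_add' _ _ := rfl
  map_smul' _ _ := rfl

/-- Put one strand to the left of an operator. -/
def addStrand : Op →ₐ[ℂ] Op where
  toFun T :=
    { toFun := fun y s => T (fixFirst (s 0) y) (seqTail s)
      map_add' := fun x y => by funext s; simp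
      map_smul' := fun c y => by funext s; simp }
  map_one' := by
    ext y s
    exact congrArg y (seqCons_seqTail s)
  map_mul' _ _ := rfl
  map_zero' := rfl
  map_add' _ _ := rfl
  commutes' c := by
    ext y s
    exact congrArg (fun t => c * y t) (seqCons_seqTail s)

theorem addStrand_apply (T : Op) (y : StateSpace) (s : ℕ → Bool) :
    addStrand T y s = T (fixFirst (s 0) y) (seqTail s) := rfl

/-- Put `k` strands to the left of an operator. -/
def addStrands : ℕ → Op →ₐ[ℂ] Op
  | 0 => AlgHom.id ℂ Op
  | k + 1 => addStrand.comp (addStrands k)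

@[simp] theorem addStrands_zero (T : Op) : addStrands 0 T = T := rfl

theorem addStrands_succ (k : ℕ) (T : Op) :
    addStrands (k + 1) T = addStrand (addStrands k T) := rfl

theorem addStrands_add (j k : ℕ) (T : Op) :
    addStrands (j + k) T = addStrands j (addStrands k T) := by
  induction j with
  | zero => simp
  | succ j ih => rw [Nat.succ_add, addStrands_succ, addStrands_succ, ih]

/-! ### Operators of minima, maxima, crossings and diagrams attached to a pairing. -/

/-- A nondegenerate bilinear form in two variables and its inverse. -/
structure Pairing where
  cupCoeff : Bool → Bool → ℂ
  capCoeff : Bool → Bool → ℂ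
  cap_mul_cup : ∀ a c, ∑ b, capCoeff a b * cupCoeff b c = if a = c then 1 else 0
  cup_mul_cap : ∀ a c, ∑ b, cupCoeff a b * capCoeff b c = if a = c then 1 else 0

namespace Pairing

variable (P : Pairing)

/-- The value of a circle. -/
def loop : ℂ := ∑ a, ∑ b, P.cupCoeff a b * P.capCoeff a b

/-- The operator of a local minimum. -/
def cupOp : Op where
  toFun y := fun s => ∑ a, ∑ b, P.cupCoeff a b * y (seqCons a (seqCons b s))
  map_add' x y := by
    funext s
    simp only [Pi.add_apply, mul_add, Finset.sum_add_distrib]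
  map_smul' c y := by
    funext s
    simp only [Pi.smul_apply, smul_eq_mul, Finset.mul_sum, RingHom.id_apply]
    exact Finset.sum_congr rfl fun a _ => Finset.sum_congr rfl fun b _ => by ring

/-- The operator of a local maximum. -/
def capOp : Op where
  toFun y := fun s => P.capCoeff (s 0) (s 1) * y (seqTail (seqTail s))
  map_add' x y := by funext s; simp only [Pi.add_apply, mul_add]
  map_smul' c y := by
    funext s
    simp only [Pi.smul_apply, smul_eq_mul, RingHom.id_apply]
    ring

theorem cupOp_apply (y : StateSpace) (s : ℕ → Bool) :
    P.cupOp y s = ∑ a, ∑ b, P.cupCoeff a b * y (seqCons a (seqCons b s)) := rfl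

theorem capOp_apply (y : StateSpace) (s : ℕ → Bool) :
    P.capOp y s = P.capCoeff (s 0) (s 1) * y (seqTail (seqTail s)) := rfl

theorem cupOp_eq (y : StateSpace) :
    P.cupOp y = ∑ a, ∑ b, P.cupCoeff a b • fixFirst b (fixFirst a y) := by
  funext s
  simp [cupOp_apply, fixFirst]

theorem fixFirst_fixFirst_capOp (a b : Bool) (y : StateSpace) :
    fixFirst b (fixFirst a (P.capOp y)) = P.capCoeff a b • y := rfl

/-- `addStrands 2 T` applies `T` once for each choice of the first two colours, and `cupOp` is a
finite linear combination over these choices, so linearity of `T` is enough. -/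
theorem cupOp_mul_addStrands_two (T : Op) : P.cupOp * addStrands 2 T = T * P.cupOp := by
  refine LinearMap.ext fun y => ?_
  rw [Module.End.mul_apply, Module.End.mul_apply, cupOp_eq, cupOp_eq]
  simp only [map_sum, map_smul]
  rfl

theorem addStrands_two_mul_capOp (T : Op) : addStrands 2 T * P.capOp = P.capOp * T := by
  refine LinearMap.ext fun y => funext fun s => ?_
  rw [Module.End.mul_apply, Module.End.mul_apply]
  change T (fixFirst (s 1) (fixFirst (s 0) (P.capOp y))) (seqTail (seqTail s)) = _
  rw [fixFirst_fixFirst_capOp, map_smul]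
  rfl

theorem cupOp_mul_capOp : P.cupOp * P.capOp = P.loop • (1 : Op) := by
  refine LinearMap.ext fun y => ?_
  rw [Module.End.mul_apply, cupOp_eq]
  simp only [fixFirst_fixFirst_capOp, smul_smul, ← Finset.sum_smul]
  rfl

/-- Summing over the colour of the middle strand contracts the two mutually inverse matrices to a
Kronecker delta. This is why zigzags straighten for every pairing. -/
theorem cupOp_mul_addStrand_capOp : P.cupOp * addStrand P.capOp = 1 := by
  refine LinearMap.ext fun y => funext fun s => ?_
  have h (a : Bool) : ∑ b, P.cupCoeff a b * (addStrand P.capOp y) (seqCons a (seqCons b s)) =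
      if a = s 0 then y (seqCons a (seqTail s)) else 0 := by
    have := congrArg (· * y (seqCons a (seqTail s))) (P.cup_mul_cap a (s 0))
    simp only [Finset.sum_mul, ite_mul, one_mul, zero_mul] at this
    rw [← this]
    refine Finset.sum_congr rfl fun b _ => ?_
    rw [mul_assoc]
    rfl
  rw [Module.End.mul_apply, cupOp_apply]
  simp only [h]
  simp

theorem addStrand_cupOp_mul_capOp : addStrand P.cupOp * P.capOp = 1 := by
  refine LinearMap.ext fun y => funext fun s => ?_
  have h (b : Bool) : ∑ a, P.cupCoeff a b * (P.capOp y)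
      (seqCons (s 0) (seqCons a (seqCons b (seqTail s)))) =
      if s 0 = b then y (seqCons b (seqTail s)) else 0 := by
    have := congrArg (· * y (seqCons b (seqTail s))) (P.cap_mul_cup (s 0) b)
    simp only [Finset.sum_mul, ite_mul, one_mul, zero_mul] at this
    rw [← this]
    refine Finset.sum_congr rfl fun a _ => ?_
    rw [mul_comm (P.capCoeff _ _), mul_assoc]
    rfl
  rw [Module.End.mul_apply, addStrand_apply, cupOp_apply, Finset.sum_comm]
  simp only [fixFirst, LinearMap.coe_mk, AddHom.coe_mk, h]
  simp

/-- The operator of a maximum below a minimum. -/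
def hookOp : Op := P.capOp * P.cupOp

/-- The operator of a crossing. -/
noncomputable def crossingOp (A : ℂ) (o : Bool) : Op :=
  (if o then A else A⁻¹) • (1 : Op) + (if o then A⁻¹ else A) • P.hookOp

variable {ι : Type} (A : ℂ) (H : ι → Op)

/-- The operator of the nontrivial part of a slice, with operators `H` in the holes. -/
noncomputable def kindOp : Kind ι → Op
  | .cup => P.cupOp
  | .cap => P.capOp
  | .crossing o => P.crossingOp A o
  | .hole i => H i

/-- The operator of a stack of slices. It maps functions of the colours of the top endpoints to
functions of the colours of the bottom endpoints. -/
noncomputable def eval : List (Slice ι) → Op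
  | [] => 1
  | s :: w => addStrands s.pos (P.kindOp A H s.kind) * eval w

@[simp] theorem eval_nil : P.eval A H [] = 1 := rfl

theorem eval_cons (s : Slice ι) (w : List (Slice ι)) :
    P.eval A H (s :: w) = addStrands s.pos (P.kindOp A H s.kind) * P.eval A H w := rfl

theorem eval_append (u v : List (Slice ι)) :
    P.eval A H (u ++ v) = P.eval A H u * P.eval A H v := by
  induction u with
  | nil => simp
  | cons s u ih => rw [List.cons_append, eval_cons, ih, eval_cons, mul_assoc]

theorem eval_shift (k : ℕ) (w : List (Slice ι)) :
    P.eval A H (shift k w) = addStrands k (P.eval A H w) := by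
  induction w with
  | nil => simp [shift]
  | cons s w ih =>
    have : shift k (s :: w) = ⟨s.kind, k + s.pos⟩ :: shift k w := rfl
    rw [this, eval_cons, ih, eval_cons, map_mul, addStrands_add]

/-- A tangle enters the evaluation of a link only through its operator; this reduces fillings to
linear algebra in the holes. -/
theorem eval_fillWord {κ : Type} (H' : κ → Op) (E : ι → Diagram κ 2 2) (w : List (Slice ι)) :
    P.eval A H' (fillWord E w) = P.eval A (fun i => P.eval A H' (E i).word) w := by
  induction w with
  | nil => rfl
  | cons s w ih =>
    obtain ⟨s, k⟩ := s
    cases s with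
    | hole i => rw [fillWord, eval_append, eval_shift, ih]; rfl
    | _ => rw [fillWord, eval_cons, ih]; rfl

theorem hookOp_mul_addStrands_two (T : Op) :
    P.hookOp * addStrands 2 T = addStrands 2 T * P.hookOp := by
  rw [hookOp, mul_assoc, cupOp_mul_addStrands_two, ← mul_assoc, ← addStrands_two_mul_capOp,
    mul_assoc]

theorem crossingOp_mul_addStrands_two (o : Bool) (T : Op) :
    P.crossingOp A o * addStrands 2 T = addStrands 2 T * P.crossingOp A o := by
  simp only [crossingOp, add_mul, mul_add, smul_mul_assoc, mul_smul_comm, one_mul, mul_one,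
    hookOp_mul_addStrands_two]

theorem kindOp_mul_addStrands (H : Empty → Op) (s : Kind Empty) (T : Op) :
    P.kindOp A H s * addStrands s.outs T = addStrands s.ins T * P.kindOp A H s := by
  cases s with
  | cup => exact P.cupOp_mul_addStrands_two T
  | cap => exact (P.addStrands_two_mul_capOp T).symm
  | crossing o => exact P.crossingOp_mul_addStrands_two A o T
  | hole i => exact i.elim

/-- Parts of a diagram that lie side by side commute. -/
theorem eval_interchange (H : Empty → Op) (s t : Kind Empty) (k m : ℕ) :
    P.eval A H [⟨s, k⟩, ⟨t, k + s.outs + m⟩] = P.eval A H [⟨t, k + s.ins + m⟩, ⟨s, k⟩] := by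
  simp only [eval_cons, eval_nil, mul_one, add_assoc, addStrands_add k, ← map_mul,
    addStrands_add s.outs, addStrands_add s.ins, kindOp_mul_addStrands]

theorem eval_cup_cap_same (k : ℕ) :
    P.eval A H [⟨.cup, k⟩, ⟨.cap, k⟩] = P.loop • (1 : Op) := by
  simp only [eval_cons, eval_nil, mul_one, kindOp, ← map_mul, cupOp_mul_capOp, map_smul, map_one]

theorem eval_cup_cap_succ (k : ℕ) : P.eval A H [⟨.cup, k⟩, ⟨.cap, k + 1⟩] = 1 := by
  simp only [eval_cons, eval_nil, mul_one, kindOp, addStrands_add k 1, ← map_mul]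
  rw [show addStrands 1 P.capOp = addStrand P.capOp from rfl, cupOp_mul_addStrand_capOp, map_one]

theorem eval_cup_succ_cap (k : ℕ) : P.eval A H [⟨.cup, k + 1⟩, ⟨.cap, k⟩] = 1 := by
  simp only [eval_cons, eval_nil, mul_one, kindOp, addStrands_add k 1, ← map_mul]
  rw [show addStrands 1 P.cupOp = addStrand P.cupOp from rfl, addStrand_cupOp_mul_capOp, map_one]

end Pairing

/-! ### Normal forms of diagrams without crossings -/

/-- A stack of local maxima. -/
def caps (l : List ℕ) : List (Slice Empty) := l.map fun k => ⟨.cap, k⟩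

/-- A stack of local minima. -/
def cups (l : List ℕ) : List (Slice Empty) := l.map fun k => ⟨.cup, k⟩

theorem fits_cup {ι : Type} {a b k : ℕ} {w : List (Slice ι)} :
    Fits a (⟨.cup, k⟩ :: w) b ↔ k ≤ a ∧ Fits (a + 2) w b := Iff.rfl

theorem fits_cap {ι : Type} {a b k : ℕ} {w : List (Slice ι)} :
    Fits a (⟨.cap, k⟩ :: w) b ↔ k + 2 ≤ a ∧ Fits (a - 2) w b := Iff.rfl

theorem fits_crossing {ι : Type} {a b k : ℕ} {o : Bool} {w : List (Slice ι)} :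
    Fits a (⟨.crossing o, k⟩ :: w) b ↔ k + 2 ≤ a ∧ Fits (a - 2 + 2) w b := Iff.rfl

theorem Fits.of_append {ι : Type} {u v : List (Slice ι)} {a c : ℕ} (h : Fits a (u ++ v) c) :
    ∃ b, Fits a u b ∧ Fits b v c := by
  induction u generalizing a with
  | nil => exact ⟨a, rfl, h⟩
  | cons s u ih =>
    obtain ⟨b, hb, hv⟩ := ih h.2
    exact ⟨b, ⟨h.1, hb⟩, hv⟩

/-- A local minimum slides up through a stack of local maxima. -/
theorem exists_normalForm_cup_cons (cs us : List ℕ) {a b k : ℕ}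
    (h : Fits a (⟨.cup, k⟩ :: (caps cs ++ cups us)) b) :
    ∃ (ℓ : ℕ) (cs' us' : List ℕ), Fits a (caps cs' ++ cups us') b ∧
      ∀ (P : Pairing) (A : ℂ) (H : Empty → Op), P.eval A H (⟨.cup, k⟩ :: (caps cs ++ cups us)) =
        P.loop ^ ℓ • P.eval A H (caps cs' ++ cups us') := by
  induction cs generalizing a k with
  | nil => exact ⟨0, [], k :: us, h, fun P A H => by simp [caps, cups]⟩
  | cons j cs ih =>
    have split (i : ℕ) (P : Pairing) (A : ℂ) (H : Empty → Op) :
        P.eval A H (⟨.cup, i⟩ :: (caps (j :: cs) ++ cups us)) =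
          P.eval A H [⟨.cup, i⟩, ⟨.cap, j⟩] * P.eval A H (caps cs ++ cups us) := by
      rw [← P.eval_append]; rfl
    obtain ⟨h1, h2, h3⟩ : k ≤ a ∧ j + 2 ≤ a + 2 ∧ Fits (a + 2 - 2) (caps cs ++ cups us) b := h
    -- The maximum lies entirely to the right of the minimum, entirely to its left, or meets it. In
    -- the first two cases they exchange heights; in the last they form a zigzag or a circle and
    -- disappear.
    rcases lt_or_ge (k + 1) j with hj | hj
    · obtain ⟨m, rfl⟩ : ∃ m, j = k + 2 + m := ⟨j - (k + 2), by omega⟩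
      obtain ⟨c, rfl⟩ : ∃ c, a = c + 2 := ⟨a - 2, by omega⟩
      obtain ⟨ℓ, cs', us', hf, he⟩ := ih (a := c) (k := k) ⟨by change k ≤ c; omega, h3⟩
      refine ⟨ℓ, (k + m) :: cs', us', ⟨by change k + m + 2 ≤ c + 2; omega, hf⟩, fun P A H => ?_⟩
      have e := P.eval_interchange A H .cup .cap k m
      simp only [Kind.ins, Kind.outs, add_zero] at e
      rw [split, e, ← P.eval_append]
      exact (congrArg (addStrands (k + m) P.capOp * ·) (he P A H)).trans
        (mul_smul_comm _ _ _)
    · rcases lt_or_ge (j + 1) k with hk | hk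
      · obtain ⟨m, rfl⟩ : ∃ m, k = j + 2 + m := ⟨k - (j + 2), by omega⟩
        obtain ⟨c, rfl⟩ : ∃ c, a = c + 2 := ⟨a - 2, by omega⟩
        obtain ⟨ℓ, cs', us', hf, he⟩ := ih (a := c) (k := j + m) ⟨by change j + m ≤ c; omega, h3⟩
        refine ⟨ℓ, j :: cs', us', ⟨by change j + 2 ≤ c + 2; omega, hf⟩, fun P A H => ?_⟩
        have e := P.eval_interchange A H .cap .cup j m
        simp only [Kind.ins, Kind.outs, add_zero] at e
        rw [split, ← e, ← P.eval_append]
        exact (congrArg (addStrands j P.capOp * ·) (he P A H)).trans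
          (mul_smul_comm _ _ _)
      · rcases lt_trichotomy j k with hlt | rfl | hlt
        · obtain rfl : k = j + 1 := by omega
          exact ⟨0, cs, us, h3, fun P A H => by
            rw [split, P.eval_cup_succ_cap, one_mul, pow_zero, one_smul]⟩
        · exact ⟨1, cs, us, h3, fun P A H => by
            rw [split, P.eval_cup_cap_same, smul_mul_assoc, one_mul, pow_one]⟩
        · obtain rfl : j = k + 1 := by omega
          exact ⟨0, cs, us, h3, fun P A H => by
            rw [split, P.eval_cup_cap_succ, one_mul, pow_zero, one_smul]⟩

/-- A diagram consisting of local minima and local maxima only. -/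
def IsPlanar {ι : Type} (w : List (Slice ι)) : Prop :=
  ∀ s ∈ w, s.kind = .cup ∨ s.kind = .cap

/-- The normal form, with all maxima below all minima, and the number `ℓ` are chosen before the
pairing. So `ℓ` can be determined with circle value 2 and then used with circle value 0. -/
theorem exists_normalForm {w : List (Slice Empty)} (hw : IsPlanar w) {a b : ℕ}
    (h : Fits a w b) :
    ∃ (ℓ : ℕ) (cs us : List ℕ), Fits a (caps cs ++ cups us) b ∧
      ∀ (P : Pairing) (A : ℂ) (H : Empty → Op), P.eval A H w =
        P.loop ^ ℓ • P.eval A H (caps cs ++ cups us) := by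
  induction w generalizing a with
  | nil => exact ⟨0, [], [], h, fun P A H => by simp [caps, cups]⟩
  | cons s w ih =>
    obtain ⟨ℓ, cs, us, hf, he⟩ := ih (fun t ht => hw t (List.mem_cons_of_mem _ ht)) h.2
    obtain ⟨s, k⟩ := s
    rcases hw _ List.mem_cons_self with hs | hs <;> obtain rfl : s = _ := hs
    · obtain ⟨ℓ', cs', us', hf', he'⟩ := exists_normalForm_cup_cons cs us (a := a) (b := b) (k := k)
        ⟨h.1, hf⟩
      refine ⟨ℓ + ℓ', cs', us', hf', fun P A H => ?_⟩
      rw [pow_add, mul_smul, ← he', P.eval_cons, he, mul_smul_comm, P.eval_cons]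
    · refine ⟨ℓ, k :: cs, us, ⟨h.1, hf⟩, fun P A H => ?_⟩
      rw [P.eval_cons, he, mul_smul_comm]
      rfl

theorem Fits.eq_of_cups {us : List ℕ} {a b : ℕ} (h : Fits a (cups us) b) :
    b = a + 2 * us.length := by
  induction us generalizing a with
  | nil => exact (show a = b from h).symm
  | cons k us ih =>
    have := ih (fits_cup.1 h).2
    simp only [List.length_cons]
    omega

theorem Fits.eq_of_caps {cs : List ℕ} {a b : ℕ} (h : Fits a (caps cs) b) :
    a = b + 2 * cs.length := by
  induction cs generalizing a with
  | nil => exact h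
  | cons k cs ih =>
    have h' := fits_cap.1 h
    have := ih h'.2
    simp only [List.length_cons]
    omega

/-- A diagram without crossings and with two bottom endpoints is a local maximum with some
circles. -/
theorem exists_eval_eq_of_fits_two_zero {w : List (Slice Empty)} (hw : IsPlanar w)
    (h : Fits 2 w 0) :
    ∃ ℓ : ℕ, ∀ (P : Pairing) (A : ℂ) (H : Empty → Op),
      P.eval A H w = P.loop ^ ℓ • P.capOp := by
  obtain ⟨ℓ, cs, us, hf, he⟩ := exists_normalForm hw h
  obtain ⟨c, hc, hu⟩ := hf.of_append
  have h1 := hc.eq_of_caps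
  have h2 := hu.eq_of_cups
  obtain rfl : us = [] := List.length_eq_zero_iff.1 (by omega)
  obtain ⟨k, rfl⟩ := List.length_eq_one_iff.1 (show cs.length = 1 by omega)
  obtain rfl : k = 0 := by have := (fits_cap.1 hc).1; omega
  exact ⟨ℓ, fun P A H => (he P A H).trans (congrArg _ (mul_one P.capOp))⟩

/-- A diagram without crossings and with four bottom endpoints is two local maxima with some
circles. -/
theorem exists_eval_eq_of_fits_four_zero {w : List (Slice Empty)} (hw : IsPlanar w)
    (h : Fits 4 w 0) :
    ∃ ℓ j : ℕ, j ≤ 2 ∧ ∀ (P : Pairing) (A : ℂ) (H : Empty → Op),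
      P.eval A H w = P.loop ^ ℓ • P.eval A H [⟨.cap, j⟩, ⟨.cap, 0⟩] := by
  obtain ⟨ℓ, cs, us, hf, he⟩ := exists_normalForm hw h
  obtain ⟨c, hc, hu⟩ := hf.of_append
  have h1 := hc.eq_of_caps
  have h2 := hu.eq_of_cups
  obtain rfl : us = [] := List.length_eq_zero_iff.1 (by omega)
  obtain ⟨j, k, rfl⟩ := List.length_eq_two.1 (show cs.length = 2 by omega)
  have h3 := fits_cap.1 hc
  have h4 := fits_cap.1 h3.2
  obtain rfl : k = 0 := by omega
  exact ⟨ℓ, j, by omega, he⟩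

/-- A tangle diagram without crossings is one of the two trivial ones, with some circles. -/
theorem exists_eval_eq_of_fits_two_two {w : List (Slice Empty)} (hw : IsPlanar w)
    (h : Fits 2 w 2) :
    ∃ ℓ : ℕ, (∀ (P : Pairing) (A : ℂ) (H : Empty → Op), P.eval A H w = P.loop ^ ℓ • (1 : Op)) ∨
      ∀ (P : Pairing) (A : ℂ) (H : Empty → Op), P.eval A H w = P.loop ^ ℓ • P.hookOp := by
  obtain ⟨ℓ, cs, us, hf, he⟩ := exists_normalForm hw h
  obtain ⟨c, hc, hu⟩ := hf.of_append
  have h1 := hc.eq_of_caps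
  have h2 := hu.eq_of_cups
  rcases Nat.eq_zero_or_pos us.length with h0 | h0
  · obtain rfl : us = [] := List.length_eq_zero_iff.1 h0
    obtain rfl : cs = [] := List.length_eq_zero_iff.1 (by omega)
    exact ⟨ℓ, Or.inl he⟩
  · obtain ⟨j, rfl⟩ := List.length_eq_one_iff.1 (show us.length = 1 by omega)
    obtain ⟨k, rfl⟩ := List.length_eq_one_iff.1 (show cs.length = 1 by omega)
    have h3 := fits_cap.1 hc
    obtain rfl : k = 0 := by omega
    obtain rfl : c = 0 := by simp at h1; omega
    obtain rfl : j = 0 := by have := (fits_cup.1 hu).1; omega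
    exact ⟨ℓ, Or.inr fun P A H => (he P A H).trans (congrArg (P.loop ^ ℓ • P.capOp * ·)
      (mul_one P.cupOp))⟩

/-! ### Counting colourings of the closed curves -/

/-- Insert two strands of colour `a` at position `k`. -/
def insertPair : ℕ → Bool → (ℕ → Bool) → ℕ → Bool
  | 0, a, r => seqCons a (seqCons a r)
  | k + 1, a, r => seqCons (r 0) (insertPair k a (seqTail r))

/-- Remove the two strands at the positions `k` and `k + 1`. -/
def removePair : ℕ → (ℕ → Bool) → ℕ → Bool
  | 0, r => seqTail (seqTail r)
  | k + 1, r => seqCons (r 0) (removePair k (seqTail r))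

/-- The conditions on the right are those that the arcs to the left of a minimum, to its right, and
the minimum itself impose on the colours of the adjacent levels. -/
theorem eq_insertPair_iff {k : ℕ} {a : Bool} {r r' : ℕ → Bool} :
    r' = insertPair k a r ↔
      (∀ x < k, r x = r' x) ∧ (∀ x, r (k + x) = r' (k + 2 + x)) ∧ r' k = a ∧ r' (k + 1) = a := by
  induction k generalizing r r' with
  | zero =>
    constructor
    · rintro rfl
      refine ⟨by simp, fun x => ?_, rfl, rfl⟩
      rw [show 0 + 2 + x = x + 1 + 1 by omega, Nat.zero_add]
      rfl
    · rintro ⟨-, h1, h2, h3⟩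
      funext x
      match x with
      | 0 => exact h2
      | 1 => exact h3
      | x + 2 =>
        have := h1 x
        rw [show 0 + 2 + x = x + 2 by omega, Nat.zero_add] at this
        exact this.symm
  | succ k ih =>
    have key : r' = insertPair (k + 1) a r ↔
        r' 0 = r 0 ∧ seqTail r' = insertPair k a (seqTail r) := by
      constructor
      · rintro rfl
        exact ⟨rfl, rfl⟩
      · rintro ⟨h1, h2⟩
        rw [insertPair, ← h2, ← h1, seqCons_seqTail]
    rw [key, ih]
    constructor
    · rintro ⟨h0, h1, h2, h3, h4⟩
      refine ⟨fun x hx => ?_, fun x => ?_, h3, h4⟩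
      · cases x with
        | zero => exact h0.symm
        | succ x => exact h1 x (by omega)
      · have := h2 x
        rw [seqTail_apply, seqTail_apply] at this
        rw [show k + 1 + x = k + x + 1 by omega, this]
        exact congrArg r' (by omega)
    · rintro ⟨h1, h2, h3, h4⟩
      refine ⟨(h1 0 (by omega)).symm, fun x hx => h1 (x + 1) (by omega), fun x => ?_, h3, h4⟩
      have := h2 x
      rw [seqTail_apply, seqTail_apply, show k + x + 1 = k + 1 + x by omega, this]
      exact congrArg r' (by omega)

theorem eq_removePair_iff {k : ℕ} {r r' : ℕ → Bool} :
    r' = removePair k r ↔ (∀ x < k, r x = r' x) ∧ ∀ x, r (k + 2 + x) = r' (k + x) := by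
  induction k generalizing r r' with
  | zero =>
    constructor
    · rintro rfl
      refine ⟨by simp, fun x => ?_⟩
      rw [show 0 + 2 + x = x + 1 + 1 by omega, Nat.zero_add]
      rfl
    · rintro ⟨-, h1⟩
      funext x
      have := h1 x
      rw [show 0 + 2 + x = x + 1 + 1 by omega, Nat.zero_add] at this
      exact this.symm
  | succ k ih =>
    have key : r' = removePair (k + 1) r ↔
        r' 0 = r 0 ∧ seqTail r' = removePair k (seqTail r) := by
      constructor
      · rintro rfl
        exact ⟨rfl, rfl⟩
      · rintro ⟨h1, h2⟩
        rw [removePair, ← h2, ← h1, seqCons_seqTail]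
    rw [key, ih]
    constructor
    · rintro ⟨h0, h1, h2⟩
      refine ⟨fun x hx => ?_, fun x => ?_⟩
      · cases x with
        | zero => exact h0.symm
        | succ x => exact h1 x (by omega)
      · have := h2 x
        rw [seqTail_apply, seqTail_apply] at this
        rw [show k + 1 + x = k + x + 1 by omega, ← this]
        exact congrArg r (by omega)
    · rintro ⟨h1, h2⟩
      refine ⟨(h1 0 (by omega)).symm, fun x hx => h1 (x + 1) (by omega), fun x => ?_⟩
      have := h2 x
      rw [seqTail_apply, seqTail_apply, show k + x + 1 = k + 1 + x by omega, ← this]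
      exact congrArg r (by omega)

/-- The identity matrix. Circles have the value `2`. -/
def colorPairing : Pairing where
  cupCoeff a b := if a = b then 1 else 0
  capCoeff a b := if a = b then 1 else 0
  cap_mul_cup a c := by simp
  cup_mul_cap a c := by simp

theorem colorPairing_loop : colorPairing.loop = 2 := by
  simp [Pairing.loop, colorPairing]

theorem addStrands_colorPairing_cupOp (k : ℕ) (y : StateSpace) (r : ℕ → Bool) :
    addStrands k colorPairing.cupOp y r = ∑ a, y (insertPair k a r) := by
  induction k generalizing y r with
  | zero => simp [Pairing.cupOp_apply, colorPairing, insertPair]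
  | succ k ih => rw [addStrands_succ, addStrand_apply, ih]; rfl

theorem addStrands_colorPairing_capOp (k : ℕ) (y : StateSpace) (r : ℕ → Bool) :
    addStrands k colorPairing.capOp y r = if r k = r (k + 1) then y (removePair k r) else 0 := by
  induction k generalizing y r with
  | zero => simp [Pairing.capOp_apply, colorPairing, removePair]
  | succ k ih => rw [addStrands_succ, addStrand_apply, ih]; rfl

/-! ### Colourings of crossingless stacks of slices. -/

open scoped Classical in
/-- The function that is `1` if all strands have the colour `false`. -/
noncomputable def vacuum : StateSpace := fun s => if s = fun _ => false then 1 else 0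

/-- The slices respect a colouring `g` of the points. -/
def Slice.Respects {ι : Type} (j : ℕ) (s : Slice ι) (g : ℕ → ℕ → Bool) : Prop :=
  ∀ p q, Slice.Arc j s p q → g p.1 p.2 = g q.1 q.2

theorem respects_succ {ι : Type} {j : ℕ} {s : Slice ι} {g : ℕ → ℕ → Bool} :
    s.Respects (j + 1) g ↔ s.Respects j (seqTail g) := by
  constructor
  · intro h p q hpq
    refine h (p.1 + 1, p.2) (q.1 + 1, q.2) ?_
    cases hpq <;> constructor
    assumption
  · intro h p q hpq
    obtain ⟨p1, p2⟩ := p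
    obtain ⟨q1, q2⟩ := q
    -- All endpoints of these arcs are at level `j + 1` or `j + 2`, so the truncated subtraction
    -- loses nothing.
    have key : Slice.Arc j s (p1 - 1, p2) (q1 - 1, q2) ∧ 1 ≤ p1 ∧ 1 ≤ q1 := by
      cases hpq <;> refine ⟨?_, by omega, by omega⟩ <;> constructor
      assumption
    obtain ⟨h1, h2, h3⟩ := key
    have := h _ _ h1
    simp only [seqTail_apply, Nat.sub_add_cancel h2, Nat.sub_add_cancel h3] at this
    exact this

theorem respects_cup {ι : Type} {k : ℕ} {g : ℕ → ℕ → Bool} :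
    (⟨.cup, k⟩ : Slice ι).Respects 0 g ↔ ∃ a, g 1 = insertPair k a (g 0) := by
  simp only [eq_insertPair_iff]
  constructor
  · intro h
    exact ⟨g 1 k, fun x hx => h _ _ (.left _ x hx), fun x => h _ _ (.right _ x), rfl,
      (h _ _ (.cup k)).symm⟩
  · rintro ⟨a, h1, h2, h3, h4⟩ p q hpq
    cases hpq with
    | left _ x hx => exact h1 x hx
    | right _ x => exact h2 x
    | cup => exact h3.trans h4.symm

theorem respects_cap {ι : Type} {k : ℕ} {g : ℕ → ℕ → Bool} :
    (⟨.cap, k⟩ : Slice ι).Respects 0 g ↔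
      g 0 k = g 0 (k + 1) ∧ g 1 = removePair k (g 0) := by
  simp only [eq_removePair_iff]
  constructor
  · intro h
    exact ⟨h _ _ (.cap k), fun x hx => h _ _ (.left _ x hx), fun x => h _ _ (.right _ x)⟩
  · rintro ⟨h1, h2, h3⟩ p q hpq
    cases hpq with
    | left _ x hx => exact h2 x hx
    | right _ x => exact h3 x
    | cap => exact h1

/-- The colourings of a stack of slices, and of infinitely many strands to the right of it, that
have the colours `r` at the bottom and the colour `false` at the top. -/
def colorings {ι : Type} (w : List (Slice ι)) (r : ℕ → Bool) : Set (ℕ → ℕ → Bool) :=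
  {g | g 0 = r ∧ (∀ (j : ℕ) (hj : j < w.length), w[j].Respects j g) ∧
    ∀ j, w.length ≤ j → g j = fun _ => false}

theorem mem_colorings_cons {ι : Type} {s : Slice ι} {w : List (Slice ι)} {r : ℕ → Bool}
    {g : ℕ → ℕ → Bool} :
    g ∈ colorings (s :: w) r ↔ g 0 = r ∧ s.Respects 0 g ∧ seqTail g ∈ colorings w (g 1) := by
  constructor
  · rintro ⟨h1, h2, h3⟩
    refine ⟨h1, h2 0 (by simp), rfl, fun j hj => ?_, fun j hj => ?_⟩
    · exact respects_succ.1 (h2 (j + 1) (by simpa using hj))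
    · exact h3 (j + 1) (by simpa using hj)
  · rintro ⟨h1, h2, -, h3, h4⟩
    refine ⟨h1, fun j hj => ?_, fun j hj => ?_⟩
    · cases j with
      | zero => exact h2
      | succ j => exact respects_succ.2 (h3 j (by simpa using hj))
    · cases j with
      | zero => simp at hj
      | succ j => exact h4 j (by simpa using hj)

theorem seqCons_injective {α : Type} (a : α) : Function.Injective (seqCons a) :=
  fun s t h => by rw [← seqTail_seqCons a s, h, seqTail_seqCons]

theorem colorings_cup_cons {ι : Type} (k : ℕ) (w : List (Slice ι)) (r : ℕ → Bool) :
    colorings (⟨.cup, k⟩ :: w) r = seqCons r '' colorings w (insertPair k false r) ∪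
      seqCons r '' colorings w (insertPair k true r) := by
  ext g
  simp only [mem_colorings_cons, respects_cup, Set.mem_union, Set.mem_image, Bool.exists_bool]
  constructor
  · rintro ⟨rfl, h1 | h1, h2⟩
    · exact Or.inl ⟨seqTail g, h1 ▸ h2, seqCons_seqTail g⟩
    · exact Or.inr ⟨seqTail g, h1 ▸ h2, seqCons_seqTail g⟩
  · rintro (⟨g, hg, rfl⟩ | ⟨g, hg, rfl⟩)
    · exact ⟨rfl, Or.inl hg.1, by rw [seqCons_one, hg.1]; exact hg⟩
    · exact ⟨rfl, Or.inr hg.1, by rw [seqCons_one, hg.1]; exact hg⟩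

theorem colorings_cap_cons {ι : Type} (k : ℕ) (w : List (Slice ι)) (r : ℕ → Bool) :
    colorings (⟨.cap, k⟩ :: w) r =
      if r k = r (k + 1) then seqCons r '' colorings w (removePair k r) else ∅ := by
  ext g
  simp only [mem_colorings_cons, respects_cap]
  split_ifs with hr
  · simp only [Set.mem_image]
    constructor
    · rintro ⟨rfl, ⟨-, h1⟩, h2⟩
      exact ⟨seqTail g, h1 ▸ h2, seqCons_seqTail g⟩
    · rintro ⟨g, hg, rfl⟩
      exact ⟨rfl, ⟨hr, hg.1⟩, by rw [seqCons_one, hg.1]; exact hg⟩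
  · simp only [Set.mem_empty_iff_false, iff_false]
    rintro ⟨rfl, ⟨h1, -⟩, -⟩
    exact hr h1

open scoped Classical in
theorem colorings_nil {ι : Type} (r : ℕ → Bool) :
    colorings ([] : List (Slice ι)) r =
      if r = (fun _ => false) then {fun _ _ => false} else ∅ := by
  ext g
  have h : g ∈ colorings ([] : List (Slice ι)) r ↔ g 0 = r ∧ g = fun _ _ => false := by
    constructor
    · rintro ⟨h1, -, h2⟩
      exact ⟨h1, funext fun j => h2 j (Nat.zero_le _)⟩
    · rintro ⟨h1, rfl⟩
      exact ⟨h1, fun j hj => absurd hj (by simp), fun _ _ => rfl⟩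
  rw [h]
  split_ifs with hr
  · subst hr
    exact ⟨fun h => h.2, fun h => by rw [Set.mem_singleton_iff] at h; subst h; exact ⟨rfl, rfl⟩⟩
  · simp only [Set.mem_empty_iff_false, iff_false]
    rintro ⟨h1, rfl⟩
    exact hr h1.symm

/-- Colourings are built level by level from the bottom: a minimum offers two colours for its pair
of strands, a maximum demands equal colours. The operators of `colorPairing` satisfy the same
recursion, and `vacuum` is the condition at the top. -/
theorem finite_and_ncard_colorings {ι : Type} (A : ℂ) (H : ι → Op) {w : List (Slice ι)}
    (hw : IsPlanar w) (r : ℕ → Bool) :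
    (colorings w r).Finite ∧ ((colorings w r).ncard : ℂ) = colorPairing.eval A H w vacuum r := by
  induction w generalizing r with
  | nil =>
    rw [colorings_nil, Pairing.eval_nil]
    change _ ∧ _ = vacuum r
    rw [vacuum]
    split_ifs with h
    · simp
    · simp
  | cons s w ih =>
    replace ih := ih fun t ht => hw t (List.mem_cons_of_mem _ ht)
    obtain ⟨s, k⟩ := s
    rcases hw _ List.mem_cons_self with hs | hs <;> obtain rfl : s = _ := hs
    · rw [colorings_cup_cons]
      refine ⟨((ih _).1.image _).union ((ih _).1.image _), ?_⟩
      rw [Set.ncard_union_eq ?_ ((ih _).1.image _) ((ih _).1.image _),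
        Set.ncard_image_of_injective _ (seqCons_injective r),
        Set.ncard_image_of_injective _ (seqCons_injective r), Nat.cast_add, (ih _).2, (ih _).2]
      · rw [Pairing.eval_cons]
        change _ = addStrands k colorPairing.cupOp (colorPairing.eval A H w vacuum) r
        rw [addStrands_colorPairing_cupOp, Fintype.sum_bool, add_comm]
      -- The two families are told apart by the colour of strand `k` just above the minimum.
      · rw [Set.disjoint_left]
        rintro - ⟨g, hg, rfl⟩ ⟨g', hg', h⟩
        obtain rfl := seqCons_injective r h
        have h1 := (eq_insertPair_iff.1 hg.1).2.2.1
        have h2 := (eq_insertPair_iff.1 hg'.1).2.2.1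
        rw [h1] at h2
        exact Bool.false_ne_true h2
    · rw [colorings_cap_cons, Pairing.eval_cons]
      change _ ∧ _ = addStrands k colorPairing.capOp (colorPairing.eval A H w vacuum) r
      rw [addStrands_colorPairing_capOp]
      split_ifs with h
      · rw [Set.ncard_image_of_injective _ (seqCons_injective r)]
        exact ⟨(ih _).1.image _, (ih _).2⟩
      · simp

/-! ### Counting the circles of a closed diagram. -/

theorem Fits.foldl_take {ι : Type} {w : List (Slice ι)} {a b : ℕ} (h : Fits a w b) :
    (∀ (j : ℕ) (hj : j < w.length),
      w[j].pos + w[j].kind.ins ≤ (w.take j).foldl (fun a s => a - s.kind.ins + s.kind.outs) a ∧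
      (w.take (j + 1)).foldl (fun a s => a - s.kind.ins + s.kind.outs) a =
        (w.take j).foldl (fun a s => a - s.kind.ins + s.kind.outs) a -
          w[j].kind.ins + w[j].kind.outs) ∧
    (w.take w.length).foldl (fun a s => a - s.kind.ins + s.kind.outs) a = b := by
  induction w generalizing a with
  | nil => exact ⟨fun j hj => absurd hj (by simp), h⟩
  | cons s w ih =>
    obtain ⟨h1, h2⟩ := ih h.2
    refine ⟨fun j hj => ?_, by simpa using h2⟩
    cases j with
    | zero => exact ⟨h.1, by simp⟩
    | succ j => exact h1 j (by simpa using hj)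

theorem Fits.le_width {ι : Type} {w : List (Slice ι)} {b : ℕ} (h : Fits 0 w b) {j : ℕ}
    (hj : j < w.length) : w[j].pos + w[j].kind.ins ≤ width w j :=
  (h.foldl_take.1 j hj).1

theorem Fits.width_succ {ι : Type} {w : List (Slice ι)} {b : ℕ} (h : Fits 0 w b) {j : ℕ}
    (hj : j < w.length) : width w (j + 1) = width w j - w[j].kind.ins + w[j].kind.outs :=
  (h.foldl_take.1 j hj).2

theorem Fits.width_length {ι : Type} {w : List (Slice ι)} {b : ℕ} (h : Fits 0 w b) :
    width w w.length = b :=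
  h.foldl_take.2

/-- `Slice.Arc.right` has no upper bound on `x`, so it also describes strands beyond the diagram. No
arc joins a point of the diagram to one of these. -/
theorem Fits.mem_points_iff_of_arc {ι : Type} {w : List (Slice ι)} {b : ℕ} (h : Fits 0 w b) {j : ℕ}
    (hj : j < w.length) {p q : ℕ × ℕ} (hpq : Slice.Arc j w[j] p q) :
    (p.1 ≤ w.length ∧ p.2 < width w p.1) ↔ (q.1 ≤ w.length ∧ q.2 < width w q.1) := by
  have h1 := h.le_width hj
  have h2 := h.width_succ hj
  generalize w[j] = s at hpq h1 h2
  cases hpq <;> simp only [Kind.ins, Kind.outs] at h1 h2 ⊢ <;> omega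

/-- A strand beyond the diagram runs down to level 0, staying outside, and has the colour `false`
there. Hence the infinitely many extra strands do not add to the count of colourings. -/
theorem Fits.eq_false_of_mem_colorings {ι : Type} {w : List (Slice ι)} {b : ℕ} (h : Fits 0 w b)
    {g : ℕ → ℕ → Bool} (hg : g ∈ colorings w fun _ => false) {j x : ℕ}
    (hx : ¬(j ≤ w.length ∧ x < width w j)) : g j x = false := by
  obtain ⟨h1, h2, h3⟩ := hg
  induction j generalizing x with
  | zero => rw [h1]
  | succ j ih =>
    rcases Nat.lt_or_ge j w.length with hj | hj
    · have h4 := h.le_width hj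
      have h5 := h.width_succ hj
      obtain ⟨y, rfl⟩ : ∃ y, x = w[j].pos + w[j].kind.outs + y :=
        ⟨x - (w[j].pos + w[j].kind.outs), by omega⟩
      rw [← h2 j hj _ _ (.right _ y)]
      exact ih (by omega)
    · rw [h3 (j + 1) (by omega)]

open scoped Classical in
/-- The colouring of all points of the plane that extends a colouring of the closed curves. -/
noncomputable def extendColoring {ι : Type} {w : List (Slice ι)} (f : Quot (Joined w) → Bool)
    (j x : ℕ) : Bool :=
  if hx : j ≤ w.length ∧ x < width w j then f (Quot.mk _ (⟨(j, x), hx⟩ : Points w)) else false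

theorem extendColoring_point {ι : Type} {w : List (Slice ι)} (f : Quot (Joined w) → Bool)
    (p : Points w) : extendColoring f p.1.1 p.1.2 = f (Quot.mk _ p) :=
  dif_pos p.2

theorem extendColoring_of_not {ι : Type} {w : List (Slice ι)} (f : Quot (Joined w) → Bool)
    {j x : ℕ} (hx : ¬(j ≤ w.length ∧ x < width w j)) : extendColoring f j x = false :=
  dif_neg hx

theorem extendColoring_mem_colorings {ι : Type} {w : List (Slice ι)} (h : Fits 0 w 0)
    (f : Quot (Joined w) → Bool) : extendColoring f ∈ colorings w fun _ => false := by
  refine ⟨?_, fun j hj p q hpq => ?_, fun j hj => ?_⟩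
  · funext x
    exact extendColoring_of_not f (by simp [width])
  · have hpq' := h.mem_points_iff_of_arc hj hpq
    by_cases hp : p.1 ≤ w.length ∧ p.2 < width w p.1
    · rw [extendColoring_point f ⟨p, hp⟩, extendColoring_point f ⟨q, hpq'.1 hp⟩]
      exact congrArg f (Quot.sound ⟨j, hj, hpq⟩)
    · rw [extendColoring_of_not f hp, extendColoring_of_not f (fun hq => hp (hpq'.2 hq))]
  · funext x
    refine extendColoring_of_not f ?_
    rintro ⟨h1, h2⟩
    obtain rfl := le_antisymm h1 hj
    rw [h.width_length] at h2
    omega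

/-- The colouring of the closed curves given by a colouring of the points. -/
def restrictColoring {ι : Type} {w : List (Slice ι)} (g : colorings w fun _ => false) :
    Quot (Joined w) → Bool :=
  Quot.lift (fun p => g.1 p.1.1 p.1.2) fun _ _ ⟨j, hj, hpq⟩ => g.2.2.1 j hj _ _ hpq

/-- Colourings of the closed curves of a diagram are colourings of its points. -/
noncomputable def circleColoringsEquiv {ι : Type} {w : List (Slice ι)} (h : Fits 0 w 0) :
    (Quot (Joined w) → Bool) ≃ colorings w fun _ => false where
  toFun f := ⟨extendColoring f, extendColoring_mem_colorings h f⟩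
  invFun := restrictColoring
  left_inv f := by
    funext c
    induction c using Quot.ind with
    | mk p => exact extendColoring_point f p
  right_inv g := by
    refine Subtype.ext (funext fun j => funext fun x => ?_)
    change extendColoring (restrictColoring g) j x = g.1 j x
    by_cases hx : j ≤ w.length ∧ x < width w j
    · exact extendColoring_point _ ⟨(j, x), hx⟩
    · exact (extendColoring_of_not _ hx).trans (h.eq_false_of_mem_colorings g.2 hx).symm

theorem finite_points {ι : Type} (w : List (Slice ι)) : Finite (Points w) := by
  refine Finite.of_injective (β := Σ j : Fin (w.length + 1), Fin (width w j))
    (fun p => ⟨⟨p.1.1, Nat.lt_succ_of_le p.2.1⟩, ⟨p.1.2, p.2.2⟩⟩) ?_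
  rintro ⟨⟨j, x⟩, hp⟩ ⟨⟨j', x'⟩, hq⟩ h
  simp only [Sigma.mk.injEq, Fin.mk.injEq] at h
  obtain ⟨rfl, h⟩ := h
  exact Subtype.ext (Prod.ext rfl (by simpa using h))

theorem two_pow_numCircles {ι : Type} (A : ℂ) (H : ι → Op) {w : List (Slice ι)} (hw : IsPlanar w)
    (h : Fits 0 w 0) :
    (2 : ℂ) ^ numCircles w = colorPairing.eval A H w vacuum fun _ => false := by
  have := finite_points w
  have : Finite (Quot (Joined w)) := Quot.finite _
  rw [← (finite_and_ncard_colorings A H hw _).2, ← Nat.card_coe_set_eq,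
    ← Nat.card_congr (circleColoringsEquiv h), Nat.card_fun, numCircles]
  simp

/-! ### The bracket as a matrix coefficient -/

/-- The number `exp(iπ/4)`. -/
noncomputable def rootA : ℂ := Complex.exp (Complex.I * Real.pi / 4)

theorem rootA_sq : rootA ^ 2 = Complex.I := by
  rw [rootA, ← Complex.exp_nat_mul]
  refine Eq.trans ?_ Complex.exp_pi_div_two_mul_I
  congr 1
  push_cast
  ring

theorem rootA_ne_zero : rootA ≠ 0 := Complex.exp_ne_zero _

theorem inv_rootA_sq : rootA⁻¹ ^ 2 = -Complex.I := by
  rw [inv_pow, rootA_sq, Complex.inv_I]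

theorem norm_rootA : ‖rootA‖ = 1 := by
  rw [rootA, show Complex.I * Real.pi / 4 = ((Real.pi / 4 : ℝ) : ℂ) * Complex.I by push_cast; ring,
    Complex.norm_exp_ofReal_mul_I]

theorem conj_rootA : (starRingEnd ℂ) rootA = rootA⁻¹ :=
  (Complex.inv_eq_conj norm_rootA).symm

/-- The pairing of the Temperley-Lieb algebra in which circles have the value `0`. -/
noncomputable def spinPairing : Pairing where
  -- The two colourings of a circle have the weights `1 * I` and `-I * 1`, which cancel.
  cupCoeff a b := if a = b then 0 else if a then 1 else -Complex.I
  capCoeff a b := if a = b then 0 else if a then Complex.I else 1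
  cap_mul_cup a c := by cases a <;> cases c <;> simp
  cup_mul_cap a c := by cases a <;> cases c <;> simp

theorem spinPairing_loop : spinPairing.loop = 0 := by
  simp [Pairing.loop, spinPairing]

/-- The weight of a state. -/
noncomputable def stateWeight {ι : Type} (A : ℂ) {w : List (Slice ι)} (σ : State w) : ℂ :=
  ∏ c, if σ c then A else A⁻¹

theorem stateWeight_eq {ι : Type} (A : ℂ) {w : List (Slice ι)} (σ : State w) :
    stateWeight A σ = A ^ (Finset.univ.filter fun c => σ c = true).card *
      A⁻¹ ^ (Finset.univ.filter fun c => σ c = false).card := by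
  rw [stateWeight, Finset.prod_ite, Finset.prod_const, Finset.prod_const]
  simp

namespace Pairing

variable (P : Pairing) {ι : Type} (A : ℂ) (H : ι → Op)

theorem eval_split (o t : Bool) (k : ℕ) :
    P.eval A H (split o t k) = if o = t then 1 else addStrands k P.hookOp := by
  unfold split
  split_ifs
  · rfl
  · simp only [eval_cons, eval_nil, mul_one, kindOp, ← map_mul, hookOp]

theorem addStrands_crossingOp (o : Bool) (k : ℕ) :
    addStrands k (P.crossingOp A o) =
      A • P.eval A H (split o true k) + A⁻¹ • P.eval A H (split o false k) := by
  simp only [crossingOp, map_add, map_smul, map_one, eval_split]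
  cases o <;> simp [add_comm]

/-- The state sum. -/
theorem eval_eq_sum (w : List (Slice ι)) :
    P.eval A H w = ∑ σ : State w, stateWeight A σ • P.eval A H (smooth w σ) := by
  induction w with
  | nil =>
    refine (Fintype.sum_unique (ι := Fin 0 → Bool)
      (fun σ => stateWeight A (w := ([] : List (Slice ι))) σ • (1 : Op))).trans ?_ |>.symm
    exact (congrArg (· • (1 : Op)) (Fin.prod_univ_zero _)).trans (one_smul _ _)
  | cons s w ih =>
    obtain ⟨s, k⟩ := s
    cases s with
    | crossing o =>
      refine Eq.trans ?_ ((Fin.consEquiv fun _ : Fin (numCrossings w + 1) => Bool).sum_comp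
        (fun σ : State (⟨.crossing o, k⟩ :: w) =>
          stateWeight A σ • P.eval A H (smooth (⟨.crossing o, k⟩ :: w) σ)))
      rw [Fintype.sum_prod_type, Fintype.sum_bool]
      change addStrands k (P.crossingOp A o) * _ = _
      rw [P.addStrands_crossingOp A H, ih, add_mul]
      simp only [smul_mul_assoc, Finset.mul_sum, mul_smul_comm]
      congr 1 <;> refine Finset.sum_congr rfl fun σ _ => ?_ <;>
      · have hs (t : Bool) : smooth (⟨.crossing o, k⟩ :: w)
            ((Fin.consEquiv fun _ : Fin (numCrossings w + 1) => Bool) (t, σ)) =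
            split o t k ++ smooth w σ := rfl
        have hw (t : Bool) : stateWeight A (w := ⟨.crossing o, k⟩ :: w)
            ((Fin.consEquiv fun _ : Fin (numCrossings w + 1) => Bool) (t, σ)) =
            (if t then A else A⁻¹) * stateWeight A σ :=
          Fin.prod_univ_succ (n := numCrossings w) _
        rw [hs, hw, eval_append, smul_smul, mul_comm (stateWeight A σ)]
        rfl
    | _ =>
      rw [eval_cons, ih, Finset.mul_sum]
      exact Finset.sum_congr rfl fun σ _ => mul_smul_comm _ _ _

end Pairing

theorem isPlanar_smooth (w : List (Slice Empty)) (σ : State w) : IsPlanar (smooth w σ) := by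
  induction w with
  | nil => exact fun s hs => by simp [smooth] at hs
  | cons s w ih =>
    obtain ⟨s, k⟩ := s
    cases s with
    | cup => exact List.forall_mem_cons.2 ⟨Or.inl rfl, ih σ⟩
    | cap => exact List.forall_mem_cons.2 ⟨Or.inr rfl, ih σ⟩
    | crossing o =>
      refine List.forall_mem_append.2 ⟨?_, ih fun i => σ i.succ⟩
      unfold split
      split_ifs <;> simp
    | hole i => exact i.elim

theorem Fits.smooth {ι : Type} {w : List (Slice ι)} {a b : ℕ} (h : Fits a w b) (σ : State w) :
    Fits a (smooth w σ) b := by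
  induction w generalizing a with
  | nil => exact h
  | cons s w ih =>
    obtain ⟨s, k⟩ := s
    cases s with
    | crossing o =>
      obtain ⟨h1, h2⟩ := fits_crossing.1 h
      have h3 := ih h2 fun i => σ i.succ
      refine Fits.append (b := a) ?_ (by rwa [Nat.sub_add_cancel (by omega)] at h3)
      unfold split
      split_ifs
      · rfl
      · exact ⟨h1, by change k ≤ a - 2; omega, show a - 2 + 2 = a by omega⟩
    | _ => exact ⟨h.1, ih h.2 σ⟩

/-! ### Opening the lowest minimum. -/

/-- The colours `false, true, false, false, …`. -/
def upRow : ℕ → Bool := seqCons false (seqCons true fun _ => false)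

theorem capOp_vacuum_upRow : spinPairing.capOp vacuum upRow = 1 := by
  simp [Pairing.capOp_apply, upRow, spinPairing, vacuum]

/-- The opened diagram is a maximum together with `ℓ` circles, and the minimum closes the maximum to
one more circle. So `d - 1 = ℓ`, and the evaluation at circle value 0 yields `0 ^ ℓ`. -/
theorem numCircles_cup_cons {w : List (Slice Empty)} (hw : IsPlanar w) (h : Fits 2 w 0) (A : ℂ)
    (H : Empty → Op) :
    (0 : ℂ) ^ ((numCircles (⟨.cup, 0⟩ :: w) : ℤ) - 1) = spinPairing.eval A H w vacuum upRow := by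
  obtain ⟨ℓ, hℓ⟩ := exists_eval_eq_of_fits_two_zero hw h
  have h1 := two_pow_numCircles A H (w := ⟨.cup, 0⟩ :: w)
    (List.forall_mem_cons.2 ⟨Or.inl rfl, hw⟩) ⟨le_rfl, h⟩
  have h2 : colorPairing.eval A H (⟨.cup, 0⟩ :: w) = (2 : ℂ) ^ (ℓ + 1) • (1 : Op) := by
    rw [Pairing.eval_cons, hℓ, mul_smul_comm]
    change _ • (colorPairing.cupOp * colorPairing.capOp) = _
    rw [Pairing.cupOp_mul_capOp, colorPairing_loop, smul_smul, pow_succ]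
  -- The evaluation with circle value 2 determines the number of circles, since powers of 2 are
  -- distinct.
  have h3 : numCircles (⟨.cup, 0⟩ :: w) = ℓ + 1 := by
    rw [h2] at h1
    have : (2 : ℂ) ^ numCircles (⟨.cup, 0⟩ :: w) = 2 ^ (ℓ + 1) := by
      simpa [vacuum] using h1
    exact Nat.pow_right_injective le_rfl (by exact_mod_cast this)
  rw [h3, hℓ, spinPairing_loop]
  simp [capOp_vacuum_upRow]

theorem bracket_cup_cons {D : LinkDiagram} {w : List (Slice Empty)}
    (hD : D.word = ⟨.cup, 0⟩ :: w) (H : Empty → Op) :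
    bracket D = spinPairing.eval rootA H w vacuum upRow := by
  obtain ⟨v, hv⟩ := D
  obtain rfl : v = _ := hD
  have hδ : -rootA ^ 2 - rootA⁻¹ ^ 2 = 0 := by rw [rootA_sq, inv_rootA_sq]; ring
  rw [Pairing.eval_eq_sum, bracket, kauffmanBracket]
  change ∑ σ : State w, rootA ^ _ * rootA⁻¹ ^ _ *
    (-rootA ^ 2 - rootA⁻¹ ^ 2) ^ ((numCircles (⟨.cup, 0⟩ :: smooth w σ) : ℤ) - 1) = _
  rw [hδ, LinearMap.sum_apply, Finset.sum_apply]
  refine Finset.sum_congr rfl fun σ _ => ?_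
  rw [numCircles_cup_cons (isPlanar_smooth w σ) (Fits.smooth (fits_cup.1 hv).2 σ) rootA H]
  exact congrArg (· * _) (stateWeight_eq rootA σ).symm

theorem Fits.eq_nil_or_eq_cup_cons {ι : Type} {w : List (Slice ι)} {b : ℕ}
    (h : Fits 0 w b) : w = [] ∨ ∃ v, w = ⟨.cup, 0⟩ :: v ∧ Fits 2 v b := by
  cases w with
  | nil => exact Or.inl rfl
  | cons s v =>
    obtain ⟨s, k⟩ := s
    obtain ⟨h1, h2⟩ := h
    cases s <;> simp only [Kind.ins, Kind.outs] at h1 h2 <;> try omega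
    obtain rfl : k = 0 := by omega
    exact Or.inr ⟨v, rfl, h2⟩

/-! ### Invariance under isotopy -/

/-- In the Temperley-Lieb relations with circle value 0, the expansions of the two sides differ by
`d * (a ^ 2 + b ^ 2) • (U - V)`. Two crossings of the same type suffice; the coefficients `c`, `d`
of the third are free. -/
theorem braid_relation_left {R : Type*} [Ring R] [Algebra ℂ R] {U V : R} (hU : U * U = 0)
    (hV : V * V = 0) (hUVU : U * (V * U) = U) (hVUV : V * (U * V) = V) {a b : ℂ}
    (hab : a ^ 2 + b ^ 2 = 0) (c d : ℂ) :
    (a • 1 + b • U) * ((a • 1 + b • V) * (c • 1 + d • U)) =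
      (c • 1 + d • V) * ((a • 1 + b • U) * (a • 1 + b • V)) := by
  simp only [add_mul, mul_add, smul_mul_assoc, mul_smul_comm, one_mul, mul_one, smul_add, hU, hV,
    hUVU, hVUV, smul_zero, smul_smul]
  linear_combination (norm := module) (d * hab) • (U - V)

theorem braid_relation_right {R : Type*} [Ring R] [Algebra ℂ R] {U V : R} (hU : U * U = 0)
    (hV : V * V = 0) (hUVU : U * (V * U) = U) (hVUV : V * (U * V) = V) {a b : ℂ}
    (hab : a ^ 2 + b ^ 2 = 0) (c d : ℂ) :
    (c • 1 + d • U) * ((a • 1 + b • V) * (a • 1 + b • U)) =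
      (a • 1 + b • V) * ((a • 1 + b • U) * (c • 1 + d • V)) := by
  simp only [add_mul, mul_add, smul_mul_assoc, mul_smul_comm, one_mul, mul_one, smul_add, hU, hV,
    hUVU, hVUV, smul_zero, smul_smul]
  linear_combination (norm := module) (d * hab) • (U - V)

namespace Pairing

variable (P : Pairing)

theorem cupOp_mul_addStrand_hookOp : P.cupOp * addStrand P.hookOp = addStrand P.cupOp := by
  rw [hookOp, map_mul, ← mul_assoc, cupOp_mul_addStrand_capOp, one_mul]

theorem addStrand_cupOp_mul_hookOp : addStrand P.cupOp * P.hookOp = P.cupOp := by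
  rw [hookOp, ← mul_assoc, addStrand_cupOp_mul_capOp, one_mul]

theorem hookOp_mul_addStrand_capOp : P.hookOp * addStrand P.capOp = P.capOp := by
  rw [hookOp, mul_assoc, cupOp_mul_addStrand_capOp, mul_one]

theorem addStrand_hookOp_mul_capOp : addStrand P.hookOp * P.capOp = addStrand P.capOp := by
  rw [hookOp, map_mul, mul_assoc, addStrand_cupOp_mul_capOp, mul_one]

theorem hookOp_mul_addStrand_hookOp_mul_hookOp :
    P.hookOp * (addStrand P.hookOp * P.hookOp) = P.hookOp := by
  conv_lhs => enter [2, 2]; rw [hookOp]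
  rw [← mul_assoc (addStrand _), addStrand_hookOp_mul_capOp, ← mul_assoc,
    hookOp_mul_addStrand_capOp, hookOp]

theorem addStrand_hookOp_mul_hookOp_mul_addStrand_hookOp :
    addStrand P.hookOp * (P.hookOp * addStrand P.hookOp) = addStrand P.hookOp := by
  conv_lhs => enter [2, 2]; rw [hookOp, map_mul]
  rw [← mul_assoc P.hookOp, hookOp_mul_addStrand_capOp, ← mul_assoc,
    addStrand_hookOp_mul_capOp, hookOp, map_mul]

end Pairing

/-! ### The local moves at circle value 0. -/

theorem spin_cupOp_mul_capOp : spinPairing.cupOp * spinPairing.capOp = 0 := by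
  rw [Pairing.cupOp_mul_capOp, spinPairing_loop, zero_smul]

theorem spin_cupOp_mul_hookOp : spinPairing.cupOp * spinPairing.hookOp = 0 := by
  rw [Pairing.hookOp, ← mul_assoc, spin_cupOp_mul_capOp, zero_mul]

theorem spin_hookOp_mul_capOp : spinPairing.hookOp * spinPairing.capOp = 0 := by
  rw [Pairing.hookOp, mul_assoc, spin_cupOp_mul_capOp, mul_zero]

theorem spin_hookOp_mul_hookOp : spinPairing.hookOp * spinPairing.hookOp = 0 := by
  rw [Pairing.hookOp, mul_assoc, ← Pairing.hookOp, spin_cupOp_mul_hookOp, mul_zero]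

/-- The coefficient of the two vertical strands in a crossing. -/
noncomputable def idCoeff (o : Bool) : ℂ := if o then rootA else rootA⁻¹

theorem norm_idCoeff (o : Bool) : ‖idCoeff o‖ = 1 := by
  cases o <;> simp [idCoeff, norm_rootA]

theorem spin_crossingOp (o : Bool) : spinPairing.crossingOp rootA o =
    idCoeff o • (1 : Op) + idCoeff (!o) • spinPairing.hookOp := by
  cases o <;> rfl

theorem idCoeff_sq_add (o : Bool) : idCoeff o ^ 2 + idCoeff (!o) ^ 2 = 0 := by
  cases o
  · change rootA⁻¹ ^ 2 + rootA ^ 2 = 0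
    rw [rootA_sq, inv_rootA_sq]; ring
  · change rootA ^ 2 + rootA⁻¹ ^ 2 = 0
    rw [rootA_sq, inv_rootA_sq]; ring

theorem idCoeff_mul (o : Bool) : idCoeff o * idCoeff (!o) = 1 := by
  cases o
  · exact inv_mul_cancel₀ rootA_ne_zero
  · exact mul_inv_cancel₀ rootA_ne_zero

theorem spin_cupOp_mul_crossingOp (o : Bool) :
    spinPairing.cupOp * spinPairing.crossingOp rootA o = idCoeff o • spinPairing.cupOp := by
  rw [spin_crossingOp, mul_add, mul_smul_comm, mul_smul_comm, spin_cupOp_mul_hookOp, mul_one,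
    smul_zero, add_zero]

theorem spin_crossingOp_mul_capOp (o : Bool) :
    spinPairing.crossingOp rootA o * spinPairing.capOp = idCoeff o • spinPairing.capOp := by
  rw [spin_crossingOp, add_mul, smul_mul_assoc, smul_mul_assoc, spin_hookOp_mul_capOp, one_mul,
    smul_zero, add_zero]

/-- With `a = idCoeff o`, `b = idCoeff (!o)` the product is `ab + (a² + b²)U + ab U²`, where `ab =
1`, `a² + b² = 0` and `U² = 0`. -/
theorem spin_crossingOp_mul_crossingOp_not (o : Bool) :
    spinPairing.crossingOp rootA o * spinPairing.crossingOp rootA (!o) = 1 := by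
  have h1 := idCoeff_mul o
  have h2 := idCoeff_sq_add o
  rw [spin_crossingOp, spin_crossingOp, Bool.not_not]
  simp only [add_mul, mul_add, smul_mul_assoc, mul_smul_comm, one_mul, mul_one, smul_add,
    spin_hookOp_mul_hookOp, smul_zero, smul_smul]
  linear_combination (norm := module) h1 • (1 : Op) + h2 • spinPairing.hookOp

theorem spin_cupOp_mul_addStrand_crossingOp (o : Bool) :
    spinPairing.cupOp * addStrand (spinPairing.crossingOp rootA o) =
      addStrand spinPairing.cupOp * spinPairing.crossingOp rootA (!o) := by
  rw [spin_crossingOp, spin_crossingOp, Bool.not_not]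
  simp only [map_add, map_smul, map_one, mul_add, mul_smul_comm, mul_one,
    Pairing.cupOp_mul_addStrand_hookOp, Pairing.addStrand_cupOp_mul_hookOp]
  exact add_comm _ _

theorem spin_addStrand_crossingOp_mul_capOp (o : Bool) :
    addStrand (spinPairing.crossingOp rootA o) * spinPairing.capOp =
      spinPairing.crossingOp rootA (!o) * addStrand spinPairing.capOp := by
  rw [spin_crossingOp, spin_crossingOp, Bool.not_not]
  simp only [map_add, map_smul, map_one, add_mul, smul_mul_assoc, one_mul,
    Pairing.hookOp_mul_addStrand_capOp, Pairing.addStrand_hookOp_mul_capOp]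
  exact add_comm _ _

theorem spin_braid_relation {o₁ o₂ o₃ : Bool} (h : o₁ = o₂ ∨ o₂ = o₃) :
    spinPairing.crossingOp rootA o₁ *
        (addStrand (spinPairing.crossingOp rootA o₂) * spinPairing.crossingOp rootA o₃) =
      addStrand (spinPairing.crossingOp rootA o₃) *
        (spinPairing.crossingOp rootA o₂ * addStrand (spinPairing.crossingOp rootA o₁)) := by
  have hU := spin_hookOp_mul_hookOp
  have hV : addStrand spinPairing.hookOp * addStrand spinPairing.hookOp = 0 := by
    rw [← map_mul, hU, map_zero]
  have h1 := spinPairing.hookOp_mul_addStrand_hookOp_mul_hookOp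
  have h2 := spinPairing.addStrand_hookOp_mul_hookOp_mul_addStrand_hookOp
  simp only [spin_crossingOp, map_add, map_smul, map_one]
  rcases h with rfl | rfl
  · exact braid_relation_left hU hV h1 h2 (idCoeff_sq_add _) _ _
  · exact braid_relation_right hU hV h1 h2 (idCoeff_sq_add _) _ _

/-- The evaluation of a diagram without holes at `A = exp(iπ/4)`. -/
noncomputable def spinEval (w : List (Slice Empty)) : Op := spinPairing.eval rootA Empty.elim w

theorem spinEval_append (u v : List (Slice Empty)) :
    spinEval (u ++ v) = spinEval u * spinEval v := spinPairing.eval_append _ _ _ _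

/-- Local moves do not change the operator, up to a factor of absolute value `1`. -/
theorem LocalMove.exists_spinEval_eq {x y : List (Slice Empty)} (h : LocalMove x y) :
    ∃ u : ℂ, ‖u‖ = 1 ∧ spinEval x = u • spinEval y := by
  have succ (k : ℕ) (T : Op) : addStrands (k + 1) T = addStrands k (addStrand T) :=
    addStrands_add k 1 T
  cases h with
  | interchange s t k m =>
    exact ⟨1, norm_one, (spinPairing.eval_interchange _ _ s t k m).trans (one_smul _ _).symm⟩
  | zigzagLeft k =>
    exact ⟨1, norm_one, (spinPairing.eval_cup_succ_cap _ _ k).trans (one_smul _ _).symm⟩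
  | zigzagRight k =>
    exact ⟨1, norm_one, (spinPairing.eval_cup_cap_succ _ _ k).trans (one_smul _ _).symm⟩
  | slideCup o k =>
    refine ⟨1, norm_one, ?_⟩
    simp only [spinEval, Pairing.eval_cons, Pairing.eval_nil, Pairing.kindOp, mul_one, one_smul,
      succ, ← map_mul, spin_cupOp_mul_addStrand_crossingOp]
  | slideCap o k =>
    refine ⟨1, norm_one, ?_⟩
    simp only [spinEval, Pairing.eval_cons, Pairing.eval_nil, Pairing.kindOp, mul_one, one_smul,
      succ, ← map_mul, spin_addStrand_crossingOp_mul_capOp]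
  | reidemeisterOneCup o k =>
    -- Only type I moves contribute a factor other than 1: the hook closes a circle and vanishes,
    -- which leaves the coefficient of the vertical splitting.
    refine ⟨idCoeff o, norm_idCoeff o, ?_⟩
    simp only [spinEval, Pairing.eval_cons, Pairing.eval_nil, Pairing.kindOp, mul_one,
      ← map_mul, spin_cupOp_mul_crossingOp, map_smul]
  | reidemeisterOneCap o k =>
    refine ⟨idCoeff o, norm_idCoeff o, ?_⟩
    simp only [spinEval, Pairing.eval_cons, Pairing.eval_nil, Pairing.kindOp, mul_one,
      ← map_mul, spin_crossingOp_mul_capOp, map_smul]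
  | reidemeisterTwo o k =>
    refine ⟨1, norm_one, ?_⟩
    simp only [spinEval, Pairing.eval_cons, Pairing.eval_nil, Pairing.kindOp, mul_one, one_smul,
      ← map_mul, spin_crossingOp_mul_crossingOp_not, map_one]
  | reidemeisterThree o₁ o₂ o₃ h k =>
    refine ⟨1, norm_one, ?_⟩
    simp only [spinEval, Pairing.eval_cons, Pairing.eval_nil, Pairing.kindOp, mul_one, one_smul,
      succ, ← map_mul, spin_braid_relation h]

theorem Step.exists_spinEval_eq {a b : ℕ} {D D' : Diagram Empty a b} (h : Step D D') :
    ∃ u : ℂ, ‖u‖ = 1 ∧ spinEval D.word = u • spinEval D'.word := by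
  obtain ⟨l, x, y, v, hm, h1, h2⟩ := h
  obtain ⟨u, hu, he⟩ := hm.exists_spinEval_eq
  refine ⟨u, hu, ?_⟩
  rw [h1, h2]
  simp only [spinEval_append, he, mul_smul_comm, smul_mul_assoc]

/-- Isotopic diagrams have the same operator, up to a factor of absolute value `1`. -/
theorem exists_spinEval_eq_of_isotopic {a b : ℕ} {D D' : Diagram Empty a b}
    (h : Relation.EqvGen Step D D') :
    ∃ u : ℂ, ‖u‖ = 1 ∧ spinEval D.word = u • spinEval D'.word := by
  induction h with
  | rel _ _ h => exact h.exists_spinEval_eq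
  | refl _ => exact ⟨1, norm_one, (one_smul _ _).symm⟩
  | symm _ _ _ ih =>
    obtain ⟨u, hu, he⟩ := ih
    have hu0 : u ≠ 0 := by rintro rfl; simp at hu
    exact ⟨u⁻¹, by simp [hu], by rw [he, smul_smul, inv_mul_cancel₀ hu0, one_smul]⟩
  | trans _ _ _ _ _ ih1 ih2 =>
    obtain ⟨u, hu, he⟩ := ih1
    obtain ⟨v, hv, he'⟩ := ih2
    exact ⟨u * v, by simp [hu, hv], by rw [he, he', smul_smul]⟩

/-! ### Invariance of the absolute value of the bracket. -/

theorem exists_spinEval_eq_smul_capOp {w : List (Slice Empty)} (h : Fits 2 w 0) :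
    ∃ c : ℂ, spinEval w = c • spinPairing.capOp := by
  choose ℓ hℓ using fun σ : State w =>
    exists_eval_eq_of_fits_two_zero (isPlanar_smooth w σ) (h.smooth σ)
  refine ⟨∑ σ : State w, stateWeight rootA σ * spinPairing.loop ^ ℓ σ, ?_⟩
  rw [spinEval, Pairing.eval_eq_sum, Finset.sum_smul]
  exact Finset.sum_congr rfl fun σ _ => by rw [hℓ, smul_smul]

/-- On diagrams with four bottom endpoints the two ways to join the first two or the last two of
them agree. -/
theorem spinEval_cup_two_cons {w : List (Slice Empty)} (h : Fits 4 w 0) :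
    spinEval (⟨.cup, 2⟩ :: w) = spinEval (⟨.cup, 0⟩ :: w) := by
  have h0 : spinEval [⟨.cup, 0⟩, ⟨.cap, 0⟩] = 0 := by
    rw [spinEval, Pairing.eval_cup_cap_same, spinPairing_loop, zero_smul]
  have h2 : spinEval [⟨.cup, 2⟩, ⟨.cap, 2⟩] = 0 := by
    rw [spinEval, Pairing.eval_cup_cap_same, spinPairing_loop, zero_smul]
  have key (j : ℕ) (hj : j ≤ 2) :
      spinEval ([⟨.cup, 2⟩] ++ [⟨.cap, j⟩, ⟨.cap, 0⟩]) =
        spinEval ([⟨.cup, 0⟩] ++ [⟨.cap, j⟩, ⟨.cap, 0⟩]) := by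
    have hs (i : ℕ) : spinEval ([⟨.cup, i⟩] ++ [⟨.cap, j⟩, ⟨.cap, 0⟩]) =
        spinEval [⟨.cup, i⟩, ⟨.cap, j⟩] * spinEval [⟨.cap, 0⟩] := by
      rw [← spinEval_append]; rfl
    have e1 : spinEval [⟨.cap, 0⟩, ⟨.cup, 0⟩] = spinEval [⟨.cup, 2⟩, ⟨.cap, 0⟩] :=
      spinPairing.eval_interchange rootA Empty.elim .cap .cup 0 0
    have e2 : spinEval [⟨.cup, 0⟩, ⟨.cap, 2⟩] = spinEval [⟨.cap, 0⟩, ⟨.cup, 0⟩] :=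
      spinPairing.eval_interchange rootA Empty.elim .cup .cap 0 0
    have e3 : spinEval [⟨.cap, 0⟩, ⟨.cup, 0⟩] * spinEval [⟨.cap, 0⟩] = 0 := by
      rw [← spinEval_append]
      change spinEval ([⟨.cap, 0⟩] ++ [⟨.cup, 0⟩, ⟨.cap, 0⟩]) = 0
      rw [spinEval_append, h0, mul_zero]
    -- For `j = 0` and `j = 2` a circle closes on both sides and both operators are 0; for `j = 1`
    -- both minima straighten to the same maximum.
    interval_cases j
    · rw [hs, hs, h0, ← e1, e3, zero_mul]
    · rw [hs, hs]
      exact congrArg (· * spinEval [⟨.cap, 0⟩])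
        ((spinPairing.eval_cup_succ_cap rootA Empty.elim 1).trans
          (spinPairing.eval_cup_cap_succ rootA Empty.elim 0).symm)
    · rw [hs, hs, h2, e2, e3, zero_mul]
  have hcons (i : ℕ) : spinEval (⟨.cup, i⟩ :: w) = spinEval [⟨.cup, i⟩] * spinEval w := by
    rw [← spinEval_append]; rfl
  rw [hcons, hcons]
  conv_lhs => rw [spinEval.eq_1 w, Pairing.eval_eq_sum]
  conv_rhs => rw [spinEval.eq_1 w, Pairing.eval_eq_sum]
  rw [Finset.mul_sum, Finset.mul_sum]
  refine Finset.sum_congr rfl fun σ _ => ?_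
  obtain ⟨ℓ, j, hj, he⟩ := exists_eval_eq_of_fits_four_zero (isPlanar_smooth w σ) (h.smooth σ)
  have := key j hj
  rw [spinEval_append, spinEval_append] at this
  simp only [he, mul_smul_comm]
  exact congrArg (fun T => stateWeight rootA σ • spinPairing.loop ^ ℓ • T) this

theorem bracket_eq_spinEval {D : LinkDiagram} {w : List (Slice Empty)}
    (hD : D.word = ⟨.cup, 0⟩ :: w) : bracket D = spinEval w vacuum upRow :=
  bracket_cup_cons hD _

/-- A move above the first slice takes place inside the opened diagram and multiplies its operator
by a unit. Moves that involve the first slice need a separate argument, because the bracket is read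
off after that slice has been removed. -/
theorem Step.norm_bracket_eq {D D' : LinkDiagram} (h : Step D D') :
    ‖bracket D‖ = ‖bracket D'‖ := by
  obtain ⟨l, x, y, v, hm, h1, h2⟩ := h
  have f1 := D.fits
  have f2 := D'.fits
  rw [h1] at f1
  rw [h2] at f2
  cases l with
  | cons s l =>
    obtain ⟨u, hu, he⟩ := hm.exists_spinEval_eq
    obtain h | ⟨t, ht, -⟩ := f1.eq_nil_or_eq_cup_cons
    · simp at h
    · rw [List.cons_append, List.cons_append, List.cons.injEq] at ht
      obtain ⟨rfl, rfl⟩ := ht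
      rw [bracket_eq_spinEval (w := l ++ x ++ v) h1, bracket_eq_spinEval (w := l ++ y ++ v) h2]
      simp only [spinEval_append, he, mul_smul_comm, smul_mul_assoc, LinearMap.smul_apply,
        Pi.smul_apply, norm_smul, hu, one_mul]
  | nil =>
    rw [List.nil_append] at f1 f2
    rw [List.nil_append] at h1 h2
    cases hm with
    -- Both parts must be minima, as no strands enter from below. The interchange decides which of
    -- the two is lowest, hence where the link is opened.
    | interchange s t k m =>
      obtain ⟨a1, a2, a3⟩ := f1
      obtain ⟨b1, b2, b3⟩ := f2
      cases s <;> simp only [Kind.ins] at a1 a2 b1 b2 <;> try omega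
      cases t <;> simp only [Kind.outs] at a1 a2 b1 b2 <;> try omega
      obtain ⟨rfl, rfl⟩ : k = 0 ∧ m = 0 := by omega
      rw [bracket_eq_spinEval h1, bracket_eq_spinEval h2]
      exact congrArg (fun T : Op => ‖T vacuum upRow‖) (spinEval_cup_two_cons a3)
    -- The minimum under the crossing is the one opened, so the hook is killed from above instead:
    -- the rest of the diagram is a multiple of `capOp`.
    | reidemeisterOneCup o k =>
      obtain ⟨a1, -, a3⟩ := f1
      obtain rfl : k = 0 := Nat.le_zero.1 a1
      obtain ⟨c, hc⟩ := exists_spinEval_eq_smul_capOp (w := v) a3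
      rw [bracket_eq_spinEval h1, bracket_eq_spinEval h2]
      have e : spinEval (⟨.crossing o, 0⟩ :: v) = idCoeff o • spinEval v := by
        change spinPairing.crossingOp rootA o * spinEval v = _
        rw [hc, mul_smul_comm, spin_crossingOp_mul_capOp, smul_comm]
      change ‖spinEval (⟨.crossing o, 0⟩ :: v) vacuum upRow‖ = ‖spinEval v vacuum upRow‖
      rw [e, LinearMap.smul_apply, Pi.smul_apply, norm_smul, norm_idCoeff, one_mul]
    -- Every other move starts with slices that do not fit on an empty level.
    | _ =>
      have a1 := f1.1
      have a2 := f1.2.1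
      simp only [Kind.ins, Kind.outs] at a1 a2
      omega

theorem norm_bracket_eq_of_isotopic {D D' : LinkDiagram} (h : Relation.EqvGen Step D D') :
    ‖bracket D‖ = ‖bracket D'‖ := by
  induction h with
  | rel _ _ h => exact h.norm_bracket_eq
  | refl _ => rfl
  | symm _ _ _ ih => exact ih.symm
  | trans _ _ _ _ _ ih1 ih2 => exact ih1.trans ih2

/-! ### The two coefficients of a tangle -/

theorem conj_stateWeight {w : List (Slice Empty)} (σ : State w) :
    (starRingEnd ℂ) (stateWeight rootA σ) = stateWeight rootA⁻¹ σ := by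
  rw [stateWeight, stateWeight, map_prod]
  refine Finset.prod_congr rfl fun c _ => ?_
  rw [apply_ite (starRingEnd ℂ), map_inv₀, conj_rootA]

theorem Pairing.eval_mirror (P : Pairing) (A : ℂ) (H : Empty → Op) (w : List (Slice Empty)) :
    P.eval A H (w.map fun s => ⟨s.kind.mirror, s.pos⟩) = P.eval A⁻¹ H w := by
  induction w with
  | nil => rfl
  | cons s w ih =>
    obtain ⟨s, k⟩ := s
    rw [List.map_cons, eval_cons, eval_cons, ih]
    cases s with
    | crossing o => cases o <;> simp [Kind.mirror, kindOp, crossingOp]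
    | hole i => exact i.elim
    | _ => rfl

/-- A tangle is a linear combination of the two trivial tangles, and its mirror image has the
conjugate coefficients. -/
theorem exists_tangle_coeffs {w : List (Slice Empty)} (h : Fits 2 w 2) :
    ∃ a b : ℂ, spinEval w = a • (1 : Op) + b • spinPairing.hookOp ∧
      spinEval (w.map fun s => ⟨s.kind.mirror, s.pos⟩) =
        (starRingEnd ℂ) a • (1 : Op) + (starRingEnd ℂ) b • spinPairing.hookOp := by
  -- The coefficients of a state are real and do not depend on `A`, so conjugation acts on the
  -- weights only. There it replaces `A` by `A⁻¹`, as does taking the mirror image.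
  have key (σ : State w) : ∃ α β : ℝ, ∀ (A : ℂ) (H : Empty → Op),
      spinPairing.eval A H (smooth w σ) = (α : ℂ) • (1 : Op) + (β : ℂ) • spinPairing.hookOp := by
    obtain ⟨ℓ, h | h⟩ := exists_eval_eq_of_fits_two_two (isPlanar_smooth w σ) (h.smooth σ)
    · exact ⟨0 ^ ℓ, 0, fun A H => by rw [h, spinPairing_loop]; simp⟩
    · exact ⟨0, 0 ^ ℓ, fun A H => by rw [h, spinPairing_loop]; simp⟩
  choose α β hαβ using key
  refine ⟨∑ σ : State w, stateWeight rootA σ * α σ, ∑ σ : State w, stateWeight rootA σ * β σ,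
    ?_, ?_⟩
  · rw [spinEval, Pairing.eval_eq_sum, Finset.sum_smul, Finset.sum_smul, ← Finset.sum_add_distrib]
    refine Finset.sum_congr rfl fun σ _ => ?_
    rw [hαβ, smul_add, smul_smul, smul_smul]
  · rw [spinEval, Pairing.eval_mirror, Pairing.eval_eq_sum, map_sum, map_sum, Finset.sum_smul,
      Finset.sum_smul, ← Finset.sum_add_distrib]
    refine Finset.sum_congr rfl fun σ _ => ?_
    rw [hαβ, smul_add, smul_smul, smul_smul, map_mul, map_mul, conj_stateWeight,
      Complex.conj_ofReal, Complex.conj_ofReal]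

/-- Multiplication by `capOp` kills the hook and isolates `a`. The function `s ↦ [s 0 = true]`
vanishes at `upRow` but takes the value 1 there after the hook is applied, which isolates `b`. -/
theorem tangle_coeffs_unique {a b a' b' : ℂ}
    (h : a • (1 : Op) + b • spinPairing.hookOp = a' • (1 : Op) + b' • spinPairing.hookOp) :
    a = a' ∧ b = b' := by
  constructor
  · have h1 := congrArg (fun T : Op => (T * spinPairing.capOp) vacuum upRow) h
    simpa only [add_mul, smul_mul_assoc, spin_hookOp_mul_capOp, smul_zero, add_zero, one_mul,
      LinearMap.smul_apply, Pi.smul_apply, capOp_vacuum_upRow, smul_eq_mul, mul_one] using h1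
  · have h1 := congrArg (fun T : Op => T (fun s => if s 0 then 1 else 0) upRow) h
    simpa [Pairing.hookOp, Pairing.capOp_apply, Pairing.cupOp_apply, spinPairing, upRow] using h1

/-- The numerator closure of the hook has two circles and drops out; that of the vertical strands
has one. For the denominator closure the roles are exchanged. -/
theorem bracket_numerator {D : BallTangleDiagram} {a b : ℂ}
    (h : spinEval D.word = a • (1 : Op) + b • spinPairing.hookOp) : bracket D.numerator = a := by
  rw [bracket_eq_spinEval (D := D.numerator) (w := D.word ++ [⟨.cap, 0⟩]) rfl, spinEval_append, h]
  change ((a • (1 : Op) + b • spinPairing.hookOp) * (spinPairing.capOp * 1)) vacuum upRow = a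
  rw [mul_one, add_mul, smul_mul_assoc, smul_mul_assoc, spin_hookOp_mul_capOp, one_mul, smul_zero,
    add_zero, LinearMap.smul_apply, Pi.smul_apply, capOp_vacuum_upRow, smul_eq_mul, mul_one]

theorem bracket_denominator {D : BallTangleDiagram} {a b : ℂ}
    (h : spinEval D.word = a • (1 : Op) + b • spinPairing.hookOp) :
    bracket D.denominator = b := by
  rw [bracket_eq_spinEval (D := D.denominator)
    (w := [⟨.cup, 2⟩] ++ shift 1 D.word ++ ([⟨.cap, 2⟩] ++ [⟨.cap, 0⟩])) rfl]
  have h0 : spinEval [⟨.cup, 2⟩] * spinEval [⟨.cap, 2⟩] = 0 := by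
    rw [← spinEval_append]
    exact (spinPairing.eval_cup_cap_same rootA Empty.elim 2).trans
      (by rw [spinPairing_loop, zero_smul])
  have h1 : spinEval [⟨.cup, 2⟩] * spinEval [⟨.cap, 1⟩] = 1 := by
    rw [← spinEval_append]
    exact spinPairing.eval_cup_succ_cap rootA Empty.elim 1
  have h2 : spinEval [⟨.cup, 1⟩] * spinEval [⟨.cap, 2⟩] = 1 := by
    rw [← spinEval_append]
    exact spinPairing.eval_cup_cap_succ rootA Empty.elim 1
  have h3 : addStrands 1 spinPairing.hookOp = spinEval [⟨.cap, 1⟩] * spinEval [⟨.cup, 1⟩] := by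
    rw [Pairing.hookOp, map_mul]
    rfl
  have h4 : spinEval (shift 1 D.word) = a • (1 : Op) +
      b • (spinEval [⟨.cap, 1⟩] * spinEval [⟨.cup, 1⟩]) := by
    rw [spinEval, Pairing.eval_shift, ← spinEval, h, map_add, map_smul, map_smul, map_one, h3]
  have h5 : spinEval ([⟨.cup, 2⟩] ++ shift 1 D.word ++ ([⟨.cap, 2⟩] ++ [⟨.cap, 0⟩])) =
      b • spinPairing.capOp := by
    rw [spinEval_append, spinEval_append, spinEval_append, h4, mul_add, mul_smul_comm,
      mul_smul_comm, ← mul_assoc (spinEval [⟨.cup, 2⟩]), h1, one_mul, mul_one, add_mul,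
      smul_mul_assoc, smul_mul_assoc, ← mul_assoc, ← mul_assoc, h0, h2, zero_mul, smul_zero,
      zero_add, one_mul]
    rfl
  rw [h5, LinearMap.smul_apply, Pi.smul_apply, capOp_vacuum_upRow, smul_eq_mul, mul_one]

/-- The operator of a tangle with the invariant `[p; q]`. -/
noncomputable def tangleOp (p q : ℤ) : Op :=
  (p : ℂ) • (1 : Op) + (-Complex.I * q) • spinPairing.hookOp

/-- The eighth root of unity and the isotopy contribute only units. For a mirrored ball, conjugating
the coefficients turns `-I * q` into `I * q`, whence `-q`. -/
theorem exists_spinEval_of_hasInvariant {B : BallTangle} {p q : ℤ} (hB : B.HasInvariant p q)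
    {E : BallTangleDiagram} (hE : E.Represents B ∨ BallTangleDiagram.Represents E.mirror B) :
    ∃ u : ℂ, ‖u‖ = 1 ∧ (spinEval E.word = u • tangleOp p q ∨
      spinEval E.word = u • tangleOp p (-q)) := by
  obtain ⟨D, rfl, hD⟩ := hB
  obtain ⟨z, hz, hp, hq⟩ : (p, q) ∈ invariant D := by rw [hD]; exact Or.inl rfl
  have hz1 : ‖z‖ = 1 := by
    have h := congrArg norm hz
    rw [norm_pow, norm_one] at h
    exact (pow_eq_one_iff_of_nonneg (norm_nonneg z) (by norm_num)).1 h
  have hz0 : z ≠ 0 := by rintro rfl; simp at hz1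
  obtain ⟨a, b, hab, -⟩ := exists_tangle_coeffs D.fits
  rw [bracket_numerator hab] at hp
  rw [bracket_denominator hab] at hq
  simp only at hp hq
  have hDop : spinEval D.word = z⁻¹ • tangleOp p q := by
    have h1 : a = z⁻¹ * p := by rw [← hp, inv_mul_cancel_left₀ hz0]
    have h2 : b = z⁻¹ * (-Complex.I * q) := by
      rw [← hq, show -Complex.I * (Complex.I * z * b) = -(Complex.I * Complex.I) * (z * b) by ring,
        Complex.I_mul_I, neg_neg, one_mul, inv_mul_cancel_left₀ hz0]
    rw [hab, tangleOp, smul_add, smul_smul, smul_smul, ← h1, ← h2]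
  rcases hE with hE | hE
  · obtain ⟨v, hv, he⟩ := exists_spinEval_eq_of_isotopic (Quotient.exact hE)
    exact ⟨v * z⁻¹, by simp [hv, hz1], Or.inl (by rw [he, hDop, smul_smul])⟩
  · obtain ⟨v, hv, he⟩ := exists_spinEval_eq_of_isotopic (Quotient.exact hE)
    obtain ⟨c, d, hcd, hcd'⟩ := exists_tangle_coeffs E.fits
    refine ⟨(starRingEnd ℂ) (v * z⁻¹), by simp [hv, hz1], Or.inr ?_⟩
    have e := hcd'.symm.trans he
    rw [hDop, tangleOp, smul_smul, smul_add, smul_smul, smul_smul] at e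
    obtain ⟨e1, e2⟩ := tangle_coeffs_unique e
    have e1' := congrArg (starRingEnd ℂ) e1
    have e2' := congrArg (starRingEnd ℂ) e2
    rw [Complex.conj_conj] at e1' e2'
    rw [hcd, e1', e2', tangleOp, smul_add, smul_smul, smul_smul]
    simp

/-! ### Integrality -/

/-- The sum of the positions, counted from the right, of the strands of colour `true` among the
first `n` strands. -/
def gaugeExp : ℕ → (ℕ → Bool) → ℕ
  | 0, _ => 0
  | n + 1, s => gaugeExp n (seqTail s) + if s 0 then n else 0

/-- The values of `y` at `s` are integral multiples of `u * I ^ gaugeExp n s`. -/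
def IsLattice (n : ℕ) (u : ℂ) (y : StateSpace) : Prop :=
  ∀ s, ∃ z : ℤ, y s = z * (u * Complex.I ^ gaugeExp n s)

/-- `T` maps the lattices for `m` strands to the lattices for `n` strands, up to a factor `c`. -/
def MapsLattice (m n : ℕ) (c : ℂ) (T : Op) : Prop :=
  ∀ u y, IsLattice m u y → IsLattice n (c * u) (T y)

theorem IsLattice.add {n : ℕ} {u : ℂ} {x y : StateSpace} (hx : IsLattice n u x)
    (hy : IsLattice n u y) : IsLattice n u (x + y) := fun s => by
  obtain ⟨k, hk⟩ := hx s
  obtain ⟨l, hl⟩ := hy s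
  exact ⟨k + l, by rw [Pi.add_apply, hk, hl]; push_cast; ring⟩

theorem IsLattice.int_smul {n : ℕ} {u : ℂ} {y : StateSpace} (hy : IsLattice n u y) (k : ℤ) :
    IsLattice n u ((k : ℂ) • y) := fun s => by
  obtain ⟨l, hl⟩ := hy s
  exact ⟨k * l, by rw [Pi.smul_apply, hl, smul_eq_mul]; push_cast; ring⟩

theorem IsLattice.smul {n : ℕ} {u : ℂ} {y : StateSpace} (hy : IsLattice n u y) (c : ℂ) :
    IsLattice n (c * u) (c • y) := fun s => by
  obtain ⟨l, hl⟩ := hy s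
  exact ⟨l, by rw [Pi.smul_apply, hl, smul_eq_mul]; ring⟩

theorem MapsLattice.mul {l m n : ℕ} {c d : ℂ} {S T : Op} (hS : MapsLattice m n c S)
    (hT : MapsLattice l m d T) : MapsLattice l n (c * d) (S * T) := fun u y hy => by
  rw [mul_assoc]
  exact hS _ _ (hT _ _ hy)

theorem MapsLattice.smul {m n : ℕ} {c : ℂ} {T : Op} (hT : MapsLattice m n c T) (d : ℂ) :
    MapsLattice m n (d * c) (d • T) := fun u y hy => by
  rw [mul_assoc]
  exact (hT u y hy).smul d

theorem exists_I_pow_eq {m n : ℕ} (h : Even (m + n)) :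
    ∃ e : ℤ, Complex.I ^ m = e * Complex.I ^ n := by
  obtain ⟨k, hk⟩ := h
  refine ⟨(-1) ^ (k + n), ?_⟩
  push_cast
  rw [← Complex.I_sq, ← pow_mul, ← pow_add, show 2 * (k + n) + n = m + 4 * n by omega, pow_add,
    pow_mul, Complex.I_pow_four, one_pow, mul_one]

/-- A new leftmost strand of colour `true` contributes `I ^ m` to one lattice and `I ^ n` to the
other. By parity these agree up to sign. -/
theorem MapsLattice.addStrand {m n : ℕ} {c : ℂ} {T : Op} (hT : MapsLattice m n c T)
    (h : Even (m + n)) : MapsLattice (m + 1) (n + 1) c (addStrand T) := fun u y hy s => by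
  have h1 : IsLattice m (u * Complex.I ^ (if s 0 then m else 0)) (fixFirst (s 0) y) := fun t => by
    obtain ⟨z, hz⟩ := hy (seqCons (s 0) t)
    refine ⟨z, hz.trans ?_⟩
    rw [gaugeExp, seqTail_seqCons, seqCons_zero, pow_add]
    ring
  obtain ⟨z, hz⟩ := hT _ _ h1 (seqTail s)
  rw [addStrand_apply, hz, gaugeExp, pow_add]
  split_ifs
  · obtain ⟨e, he⟩ := exists_I_pow_eq h
    exact ⟨z * e, by rw [he]; push_cast; ring⟩
  · exact ⟨z, by ring⟩

theorem MapsLattice.addStrands {m n : ℕ} {c : ℂ} {T : Op} (hT : MapsLattice m n c T)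
    (h : Even (m + n)) (k : ℕ) : MapsLattice (m + k) (n + k) c (addStrands k T) := by
  induction k with
  | zero => exact hT
  | succ k ih =>
    refine ih.addStrand ?_
    rw [show m + k + (n + k) = m + n + 2 * k by ring]
    exact h.add (even_two_mul k)

theorem mapsLattice_cupOp (n : ℕ) :
    MapsLattice (n + 2) n (Complex.I ^ (n + 1)) spinPairing.cupOp := fun u y hy s => by
  obtain ⟨z₁, h₁⟩ := hy (seqCons false (seqCons true s))
  obtain ⟨z₂, h₂⟩ := hy (seqCons true (seqCons false s))
  -- Up to the common gauge factor, the two colourings of the minimum contribute `z₂ * I ^ (n + 1)`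
  -- and `-I * z₁ * I ^ n = -z₁ * I ^ (n + 1)`.
  refine ⟨z₂ - z₁, ?_⟩
  simp only [Pairing.cupOp_apply, Fintype.sum_bool, spinPairing, h₁, h₂, gaugeExp, seqTail_seqCons,
    seqCons_zero]
  simp
  ring

theorem mapsLattice_capOp (n : ℕ) :
    MapsLattice n (n + 2) (Complex.I ^ (3 * n)) spinPairing.capOp := fun u y hy s => by
  obtain ⟨z, hz⟩ := hy (seqTail (seqTail s))
  -- `I ^ (3 * n)` serves as `I ^ (-n)`, the inverse of the gauge factor of the added pair.
  have h4 : Complex.I ^ (3 * n) * Complex.I ^ n = 1 := by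
    rw [← pow_add, show 3 * n + n = 4 * n by ring, pow_mul, Complex.I_pow_four, one_pow]
  simp only [Pairing.capOp_apply, spinPairing, hz, gaugeExp, seqTail_apply, zero_add]
  cases h0 : s 0 <;> cases h1 : s 1
  · exact ⟨0, by simp⟩
  · refine ⟨z, ?_⟩
    simp only [Bool.false_eq_true, if_true, if_false, pow_add, add_zero]
    linear_combination -(z : ℂ) * u * Complex.I ^ gaugeExp n (seqTail (seqTail s)) * h4
  · refine ⟨z, ?_⟩
    simp only [Bool.false_eq_true, Bool.true_eq_false, if_true, if_false, pow_add, add_zero,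
      pow_one]
    linear_combination
      -(z : ℂ) * u * Complex.I ^ gaugeExp n (seqTail (seqTail s)) * Complex.I * h4
  · exact ⟨0, by simp⟩

/-- On two strands of opposite colours `-I • hookOp` has the diagonal entries `1`, `-1` and the
off-diagonal entries `-I`. The latter move the colour `true` to the neighbouring position, and the
gauge `I ^ gaugeExp` absorbs the factor `I` up to sign. -/
theorem mapsLattice_tangleOp (p q : ℤ) (n : ℕ) :
    MapsLattice (n + 2) (n + 2) 1 (tangleOp p q) := fun u y hy => by
  have h1 := (((mapsLattice_capOp n).mul (mapsLattice_cupOp n)).smul (-Complex.I)) u y hy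
  have h2 : -Complex.I * (Complex.I ^ (3 * n) * Complex.I ^ (n + 1)) = 1 := by
    rw [← pow_add, show 3 * n + (n + 1) = 4 * n + 1 by ring, pow_succ, pow_mul,
      Complex.I_pow_four, one_pow, one_mul, neg_mul, Complex.I_mul_I, neg_neg]
  rw [h2] at h1
  rw [one_mul] at h1 ⊢
  have h3 : tangleOp p q y =
      (p : ℂ) • y + (q : ℂ) • (-Complex.I • (spinPairing.capOp * spinPairing.cupOp)) y := by
    simp only [tangleOp, LinearMap.add_apply, LinearMap.smul_apply, Module.End.one_apply,
      smul_smul, Pairing.hookOp, mul_comm (q : ℂ)]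
  rw [h3]
  exact (hy.int_smul p).add (h1.int_smul q)

/-- Since `A² = I`, factoring out the coefficient of the vertical strands leaves `1 ∓ I • U`: a
crossing is a unit times an integral tangle operator. -/
theorem crossingOp_eq_smul_tangleOp (o : Bool) : spinPairing.crossingOp rootA o =
    idCoeff o • tangleOp 1 (if o then 1 else -1) := by
  rw [spin_crossingOp, tangleOp, smul_add, smul_smul, smul_smul]
  congr 2
  · simp
  · cases o
    · change rootA = rootA⁻¹ * _
      rw [eq_inv_mul_iff_mul_eq₀ rootA_ne_zero, ← sq, rootA_sq]
      simp
    · change rootA⁻¹ = rootA * _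
      rw [eq_comm, ← eq_inv_mul_iff_mul_eq₀ rootA_ne_zero, ← sq, inv_rootA_sq]
      simp

/-- Diagrams whose holes are filled with operators of integral tangles map lattices to lattices. -/
theorem exists_mapsLattice_eval {ι : Type} (p q : ι → ℤ) {w : List (Slice ι)} {a b : ℕ}
    (h : Fits a w b) :
    ∃ c : ℂ, ‖c‖ = 1 ∧
      MapsLattice b a c (spinPairing.eval rootA (fun i => tangleOp (p i) (q i)) w) := by
  induction w generalizing a with
  | nil =>
    obtain rfl : a = b := h
    exact ⟨1, norm_one, fun u y hy => by rwa [one_mul]⟩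
  | cons s w ih =>
    obtain ⟨s, k⟩ := s
    obtain ⟨h1, h2⟩ := h
    obtain ⟨c, hc, hT⟩ := ih h2
    have hI (j : ℕ) : ‖Complex.I ^ j‖ = 1 := by rw [norm_pow, Complex.norm_I, one_pow]
    have hs (r : ℕ) : ∃ d : ℂ, ‖d‖ = 1 ∧ MapsLattice (r + s.outs) (r + s.ins) d
        (spinPairing.kindOp rootA (fun i => tangleOp (p i) (q i)) s) := by
      cases s with
      | cup => exact ⟨_, hI _, mapsLattice_cupOp r⟩
      | cap => exact ⟨_, hI _, mapsLattice_capOp r⟩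
      | crossing o =>
        refine ⟨idCoeff o * 1, by rw [mul_one, norm_idCoeff], ?_⟩
        change MapsLattice (r + 2) (r + 2) _ (spinPairing.crossingOp rootA o)
        rw [crossingOp_eq_smul_tangleOp]
        exact (mapsLattice_tangleOp _ _ r).smul _
      | hole i => exact ⟨1, norm_one, mapsLattice_tangleOp _ _ r⟩
    have hev : Even (s.outs + s.ins) := by cases s <;> simp [Kind.ins, Kind.outs, Nat.even_iff]
    simp only at h1 h2 hT
    obtain ⟨r, rfl⟩ : ∃ r, a = r + s.ins + k := ⟨a - s.ins - k, by omega⟩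
    obtain ⟨d, hd, hS⟩ := hs r
    refine ⟨d * c, by rw [norm_mul, hd, hc, one_mul], ?_⟩
    refine (hS.addStrands ?_ k).mul ?_
    · rw [show r + s.outs + (r + s.ins) = s.outs + s.ins + 2 * r by ring]
      exact hev.add (even_two_mul r)
    · rwa [show r + s.ins + k - s.ins + s.outs = r + s.outs + k by omega] at hT

/-! ### Extracting the gcds from the holes. -/

theorem Pairing.eval_smul_holes (P : Pairing) {ι : Type} (A : ℂ) (c : ι → ℂ) (H : ι → Op)
    (w : List (Slice ι)) :
    P.eval A (fun i => c i • H i) w = ((holes w).map c).prod • P.eval A H w := by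
  induction w with
  | nil => simp [holes]
  | cons s w ih =>
    obtain ⟨s, k⟩ := s
    rw [eval_cons, ih, mul_smul_comm, eval_cons]
    cases s with
    | hole i =>
      simp only [kindOp, map_smul, smul_mul_assoc, holes, List.map_cons, List.prod_cons, smul_smul,
        mul_comm (c i)]
    | _ => rfl

theorem isLattice_vacuum : IsLattice 0 1 vacuum := fun s => by
  unfold vacuum
  split_ifs
  · exact ⟨1, by simp [gaugeExp]⟩
  · exact ⟨0, by simp⟩

theorem exists_tangleOp_eq_gcd_smul (p q : ℤ) :
    ∃ p' q' : ℤ, tangleOp p q = (Int.gcd p q : ℂ) • tangleOp p' q' := by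
  obtain ⟨p', hp⟩ := Int.gcd_dvd_left p q
  obtain ⟨q', hq⟩ := Int.gcd_dvd_right p q
  refine ⟨p', q', ?_⟩
  generalize Int.gcd p q = g at hp hq ⊢
  subst hp hq
  simp only [tangleOp, smul_add, smul_smul]
  congr 2 <;> push_cast <;> ring

theorem bracket_eq_zero_of_word_eq_nil {D : LinkDiagram} (h : D.word = []) : bracket D = 0 := by
  obtain ⟨v, hv⟩ := D
  obtain rfl : v = [] := h
  have : IsEmpty (Points ([] : List (Slice Empty))) := ⟨fun x => by
    have := x.2.2
    simp [width] at this⟩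
  have h1 : numCircles ([] : List (Slice Empty)) = 0 :=
    Nat.card_eq_zero.2 (Or.inl (inferInstanceAs (IsEmpty (Quot _))))
  have hδ : -rootA ^ 2 - rootA⁻¹ ^ 2 = 0 := by rw [rootA_sq, inv_rootA_sq]; ring
  rw [bracket, kauffmanBracket]
  refine Finset.sum_eq_zero fun σ _ => ?_
  change rootA ^ _ * rootA⁻¹ ^ _ *
    (-rootA ^ 2 - rootA⁻¹ ^ 2) ^ ((numCircles ([] : List (Slice Empty)) : ℤ) - 1) = 0
  rw [hδ, h1]
  -- The empty diagram has `d = 0`, and `0 ^ (-1 : ℤ) = 0` in Lean.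
  simp

/-- The bracket of a link diagram with tangles of integral coefficients in its holes. -/
theorem exists_norm_bracket_fill {n : ℕ} (T : Diagram (Fin n) 0 0) (E : Fin n → BallTangleDiagram)
    (hT : ∀ i, (holes T.word).count i = 1) (p q : Fin n → ℤ)
    (hE : ∀ i, ∃ u : ℂ, ‖u‖ = 1 ∧ spinEval (E i).word = u • tangleOp (p i) (q i)) :
    ∃ N : ℕ, ‖bracket (T.fill E)‖ = (N : ℝ) ∧ (∏ i, Int.gcd (p i) (q i)) ∣ N := by
  choose u hu hE using hE
  choose p' q' hpq using fun i => exists_tangleOp_eq_gcd_smul (p i) (q i)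
  obtain h | ⟨w, hw, hf⟩ := T.fits.eq_nil_or_eq_cup_cons
  · refine ⟨0, ?_, dvd_zero _⟩
    have h1 : (T.fill E).word = [] := by simp [Diagram.fill, h, fillWord]
    rw [bracket_eq_zero_of_word_eq_nil h1, norm_zero, Nat.cast_zero]
  · have hfill : (T.fill E).word = ⟨.cup, 0⟩ :: fillWord E w := by
      simp only [Diagram.fill, hw, fillWord]
    rw [hw] at hT
    -- Each label occurs exactly once, so the product over the holes is the product over all `i`.
    have hprod : ((holes w).map fun i => u i * (Int.gcd (p i) (q i) : ℂ)).prod =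
        ∏ i, (u i * (Int.gcd (p i) (q i) : ℂ)) := by
      rw [Finset.prod_list_map_count]
      refine Finset.prod_subset_one_on_sdiff (Finset.subset_univ _) (fun i hi => ?_) fun i _ => ?_
      · have : (holes w).count i = 1 := hT i
        simp only [Finset.mem_sdiff, List.mem_toFinset, ← List.count_pos_iff, this] at hi
        simp at hi
      · have : (holes w).count i = 1 := hT i
        rw [this, pow_one]
    obtain ⟨c, hc, hL⟩ := exists_mapsLattice_eval p' q' hf
    -- What remains after the gcds are extracted is the integer `z` times a complex unit; `z.natAbs`
    -- is the cofactor.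
    obtain ⟨z, hz⟩ := hL 1 vacuum isLattice_vacuum upRow
    refine ⟨(∏ i, Int.gcd (p i) (q i)) * z.natAbs, ?_, dvd_mul_right _ _⟩
    have heval : spinEval (fillWord E w) = (∏ i, (u i * (Int.gcd (p i) (q i) : ℂ))) •
        spinPairing.eval rootA (fun i => tangleOp (p' i) (q' i)) w := by
      rw [spinEval, Pairing.eval_fillWord, ← hprod, ← Pairing.eval_smul_holes]
      congr 1
      funext i
      rw [mul_smul, ← hpq]
      exact hE i
    rw [bracket_eq_spinEval hfill, heval, LinearMap.smul_apply, Pi.smul_apply, hz, smul_eq_mul]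
    simp [norm_prod, hu, hc, Nat.cast_natAbs]

end TangleDiagrams

theorem theorem3p7 (n : ℕ) (L : TangleDiagrams.Link) (B : Fin n → TangleDiagrams.BallTangle)
    (p q : Fin n → ℤ) (hB : ∀ i, (B i).HasInvariant (p i) (q i))
    (hL : TangleDiagrams.DisjointlyEmbedded B L)
    (D : TangleDiagrams.LinkDiagram) (hD : D.Represents L) :
    ∃ N : ℕ, ‖TangleDiagrams.bracket D‖ = (N : ℝ) ∧ (∏ i, Int.gcd (p i) (q i)) ∣ N := by
  obtain ⟨T, E, hT, hE, rfl⟩ := hL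
  rw [TangleDiagrams.norm_bracket_eq_of_isotopic (Quotient.exact hD)]
  -- `q'` is `q i` or, for a ball embedded with reversed orientation, `-q i`; the gcd does not see
  -- the sign.
  have key (i : Fin n) : ∃ q' : ℤ, Int.gcd (p i) q' = Int.gcd (p i) (q i) ∧
      ∃ u : ℂ, ‖u‖ = 1 ∧
        TangleDiagrams.spinEval (E i).word = u • TangleDiagrams.tangleOp (p i) q' := by
    obtain ⟨u, hu, h | h⟩ := TangleDiagrams.exists_spinEval_of_hasInvariant (hB i) (hE i)
    · exact ⟨q i, rfl, u, hu, h⟩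
    · exact ⟨-q i, Int.gcd_neg, u, hu, h⟩
  choose q' hq' hu using key
  have := TangleDiagrams.exists_norm_bracket_fill T E hT p q' hu
  simpa only [hq'] using this
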